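/- Let $A,B$ be finite-dimensional quantum systems, fix a base $>1$ for the logarithm $\log$, and let $\exp$ denote its inverse. For a finite-dimensional system $S$ let $\mathcal S_\bullet(S)$ (resp. $\mathcal S_\circ(S)$) be the set of positive semi-definite operators on $S$ of trace at most $1$ (resp. equal to $1$), and let $|X|=\sqrt{X^\dagger X}$. For positive semi-definite $\rho,\tau$ let $F(\rho,\tau)=\big(\mathrm{tr}\,|\sqrt\rho\sqrt\tau|\big)^2$. For $\rho,\tau\in\mathcal S_\bullet(S)$ let $F_*(\rho,\tau)=\big(\mathrm{tr}\,|\sqrt\rho\sqrt\tau|+\sqrt{(1-\mathrm{tr}\,\rho)(1-\mathrm{tr}\,\tau)}\big)^2$, let $P(\rho,\tau)=\sqrt{1-F_*(\rho,\tau)}$ be the purified distance, and let $\mathcal B^\varepsilon(\rho)=\{\tau\in\mathcal S_\bullet(S): P(\tau,\rho)\le\varepsilon\}$. For $\rho_{AB}\in\mathcal S_\bullet(AB)$ define $$H_{\min}(A|B)_\rho=\sup_{\sigma_B\in\mathcal S_\bullet(B)}\sup\{\lambda\in\mathbb R:\rho_{AB}\le\exp(-\lambda)\,1_A\otimes\sigma_B\},\qquad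 H_{\max}(A|B)_\rho=\sup_{\sigma_B\in\mathcal S_\bullet(B)}\log F(\rho_{AB},1_A\otimes\sigma_B)$$ (with values in $[-\infty,\infty]$, $\log 0=-\infty$), and $$H_{\min}^\varepsilon(A|B)_\rho=\sup_{\tilde\rho\in\mathcal B^\varepsilon(\rho_{AB})}H_{\min}(A|B)_{\tilde\rho},\qquad H_{\max}^\varepsilon(A|B)_\rho=\inf_{\tilde\rho\in\mathcal B^\varepsilon(\rho_{AB})}H_{\max}(A|B)_{\tilde\rho}.$$ For $\rho_{AB}\in\mathcal S_\circ(AB)$ let $H(A|B)_\rho=-\mathrm{tr}(\rho_{AB}\log\rho_{AB})+\mathrm{tr}(\rho_B\log\rho_B)$ with $\rho_B=\mathrm{tr}_A\,\rho_{AB}$ and $0\log 0=0$. **Corollary (direct part of the fully quantum asymptotic equipartition property).** Let $\rho_{AB}\in\mathcal S_\circ(AB)$ and $0<\varepsilon<1$. Then the following two limits exist, are finite, and satisfy $$\lim_{n\to\infty}\frac1n H_{\min}^\varepsilon(A^n|B^n)_{\rho_{AB}^{\otimes n}}\ \ge\ H(A|B)_\rho\qquad\text{and}\qquad \lim_{n\to\infty}\frac1n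 H_{\max}^\varepsilon(A^n|B^n)_{\rho_{AB}^{\otimes n}}\ \le\ H(A|B)_\rho .$$ -/

import Mathlib

open scoped Matrix Kronecker ComplexOrder MatrixOrder Topology

namespace QuantumAEP

noncomputable section

/-- Positive semi-definite operators of trace at most one on the finite-dimensional
Hilbert space with orthonormal basis indexed by `S`. -/
def IsSubnormalized {S : Type*} [Fintype S] (ρ : Matrix S S ℂ) : Prop :=
  ρ.PosSemidef ∧ ρ.trace.re ≤ 1

/-- Normalized density operators. -/
def IsState {S : Type*} [Fintype S] (ρ : Matrix S S ℂ) : Prop :=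
  ρ.PosSemidef ∧ ρ.trace = 1

/-- The partial trace over the first tensor factor. -/
def partialTraceLeft {A B : Type*} [Fintype A] (ρ : Matrix (A × B) (A × B) ℂ) :
    Matrix B B ℂ :=
  Matrix.of fun b b' => ∑ a, ρ (a, b) (a, b')

/-- The `n`-fold tensor power of `ρ_AB`, with the factors reordered so that it acts on
`Aⁿ ⊗ Bⁿ`. -/
def tensorPower {A B : Type*} (n : ℕ) (ρ : Matrix (A × B) (A × B) ℂ) :
    Matrix ((Fin n → A) × (Fin n → B)) ((Fin n → A) × (Fin n → B)) ℂ :=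
  Matrix.of fun x y => ∏ i, ρ (x.1 i, x.2 i) (y.1 i, y.2 i)

/-- The trace norm `tr |X|`, where `|X| = √(X† X)`. -/
def traceNorm {S : Type*} [Fintype S] [DecidableEq S] (X : Matrix S S ℂ) : ℝ :=
  (CFC.abs X).trace.re

/-- The fidelity `F(ρ, τ) = (tr |√ρ √τ|)²` of positive semi-definite operators. -/
def fidelity {S : Type*} [Fintype S] [DecidableEq S] (ρ τ : Matrix S S ℂ) : ℝ :=
  (traceNorm (CFC.sqrt ρ * CFC.sqrt τ)) ^ 2

/-- The generalized fidelity of sub-normalized density operators. -/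
def genFidelity {S : Type*} [Fintype S] [DecidableEq S] (ρ τ : Matrix S S ℂ) : ℝ :=
  (traceNorm (CFC.sqrt ρ * CFC.sqrt τ)
    + Real.sqrt ((1 - ρ.trace.re) * (1 - τ.trace.re))) ^ 2

/-- The purified distance of sub-normalized density operators. -/
def purifiedDistance {S : Type*} [Fintype S] [DecidableEq S] (ρ τ : Matrix S S ℂ) : ℝ :=
  Real.sqrt (1 - genFidelity ρ τ)

/-- The `ε`-ball of sub-normalized density operators around `ρ`. -/
def epsBall {S : Type*} [Fintype S] [DecidableEq S] (ε : ℝ) (ρ : Matrix S S ℂ) :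
    Set (Matrix S S ℂ) :=
  {τ | IsSubnormalized τ ∧ purifiedDistance τ ρ ≤ ε}

/-- The von Neumann entropy `-tr (ρ log ρ)`, with the logarithm to base `b`. -/
def vonNeumannEntropy {S : Type*} [Fintype S] [DecidableEq S] (b : ℝ)
    (ρ : Matrix S S ℂ) : ℝ :=
  -(cfc (fun x : ℝ => x * Real.logb b x) ρ).trace.re

/-- The conditional von Neumann entropy `H(A|B) = H(AB) - H(B)`. -/
def condEntropy {A B : Type*} [Fintype A] [DecidableEq A] [Fintype B] [DecidableEq B]
    (b : ℝ) (ρ : Matrix (A × B) (A × B) ℂ) : ℝ :=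
  vonNeumannEntropy b ρ - vonNeumannEntropy b (partialTraceLeft ρ)

/-- The min-entropy of `A` conditioned on `B`: the supremum, over sub-normalized `σ_B`, of
all real `t` with `ρ_AB ≤ b ^ (-t) • (1_A ⊗ σ_B)`. -/
def minEntropy {A B : Type*} [Fintype A] [DecidableEq A] [Fintype B] [DecidableEq B]
    (b : ℝ) (ρ : Matrix (A × B) (A × B) ℂ) : EReal :=
  ⨆ σ ∈ {σ : Matrix B B ℂ | IsSubnormalized σ},
    ⨆ t ∈ {t : ℝ | ρ ≤ (b ^ (-t) : ℝ) • ((1 : Matrix A A ℂ) ⊗ₖ σ)}, (t : EReal)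

/-- The logarithm to base `b` of a non-negative real, with value `-∞` at `0`. -/
def elogb (b x : ℝ) : EReal :=
  if x = 0 then ⊥ else (Real.logb b x : EReal)

/-- The max-entropy of `A` conditioned on `B`: the supremum of `log F(ρ_AB, 1_A ⊗ σ_B)`
over sub-normalized `σ_B`. -/
def maxEntropy {A B : Type*} [Fintype A] [DecidableEq A] [Fintype B] [DecidableEq B]
    (b : ℝ) (ρ : Matrix (A × B) (A × B) ℂ) : EReal :=
  ⨆ σ ∈ {σ : Matrix B B ℂ | IsSubnormalized σ},
    elogb b (fidelity ρ ((1 : Matrix A A ℂ) ⊗ₖ σ))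

/-- The `ε`-smooth min-entropy. -/
def smoothMinEntropy {A B : Type*} [Fintype A] [DecidableEq A] [Fintype B] [DecidableEq B]
    (b ε : ℝ) (ρ : Matrix (A × B) (A × B) ℂ) : EReal :=
  ⨆ τ ∈ epsBall ε ρ, minEntropy b τ

/-- The `ε`-smooth max-entropy. -/
def smoothMaxEntropy {A B : Type*} [Fintype A] [DecidableEq A] [Fintype B] [DecidableEq B]
    (b ε : ℝ) (ρ : Matrix (A × B) (A × B) ℂ) : EReal :=
  ⨅ τ ∈ epsBall ε ρ, maxEntropy b τ

end

end QuantumAEP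

/-!
Both normalized smooth entropies converge to `H(A|B)`, for every `0 < ε < 1`. This gives the
existence of the limits together with the two inequalities.

Diagonalize `ρ_AB = U diag(p) U†` and `ρ_B = V diag(q) V†`, and let `W = U† (1 ⊗ V)` be the matrix of
overlaps. The weights `p_i |W_ij|²` form the Nussbaum–Szkoła probability distribution on pairs of
eigenvalues (`SpectralData.weight`). For tensor powers it is a product distribution, and the mean of
`log p_i - log q_j` is `-H(A|B)` (`SpectralData.sum_weight_mul_logRatio`).

Given a set `T` of pairs of eigenvalues, let `Z` be the identity operator with only those matrix
elements kept, between an eigenvector of `ρ_AB` and one of `1 ⊗ ρ_B`, whose eigenvalues lie in `T`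
(`SpectralData.maskedOne`). Then `√ρ Z` differs from `√ρ` in Hilbert–Schmidt norm by the square root
of the mass outside `T`. Hence `Z† ρ Z` is close to `ρ` if this mass is small
(`SpectralData.smoothed_mem_epsBall`), and any state in the `ε`-ball keeps a definite amount of root
fidelity with `ρ` after masking (`SpectralData.le_traceNorm_of_mem_epsBall`). With `v` the number of
distinct eigenvalues of `ρ_B`, a pinching argument (`gram_le_card_smul_pinchedGram`) gives

* for `T = {p ≤ l q}`, a factorization `√ρ Z = Y √(1 ⊗ ρ_B)` with `Y† Y ≤ v l`
  (`SpectralData.exists_bounded_factor`);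
* for `T = {0 < q ≤ l p}`, the bound `tr Z† Z (1 ⊗ σ) ≤ v l` for every subnormalized `σ`
  (`SpectralData.hsNormSq_maskedOne_mul_le`).

The first operator bounds both smooth entropies from below, the second bounds both from above. For
the min-entropy, the lower bound comes from the smoothed state `Z† ρ Z` and the upper bound from the
test operator `Z† Z`; for the max-entropy the lower bound comes from the choice `σ = ρ_B` and the
upper bound from the smoothed state.

For `n` copies `l` is taken as `b ^ (n x)`, with `x` slightly above `-H(A|B)` in the first case and
slightly above `H(A|B)` in the second. The mass outside `T` then tends to zero by a Chernoff bound
(`SpectralData.tendsto_power_mass`), and `v` is polynomial in `n`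
(`SpectralData.power_numEigenvalues_le`), so that the bounds agree to first order.
-/

namespace QuantumAEP

/-! ### Trace norm and Hilbert–Schmidt norm -/

section TraceNorm

variable {S : Type*} [Fintype S]

/-- The squared Hilbert–Schmidt norm `tr X†X`. -/
noncomputable def hsNormSq (X : Matrix S S ℂ) : ℝ :=
  (Xᴴ * X).trace.re

theorem hsNormSq_eq_sum (X : Matrix S S ℂ) : hsNormSq X = ∑ i, ∑ j, ‖X i j‖ ^ 2 := by
  rw [hsNormSq, Finset.sum_comm]
  simp only [Matrix.trace, Matrix.diag, Matrix.mul_apply, Matrix.conjTranspose_apply,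
    Complex.re_sum, RCLike.star_def, Complex.conj_mul']
  norm_cast

theorem hsNormSq_nonneg (X : Matrix S S ℂ) : 0 ≤ hsNormSq X := by
  rw [hsNormSq_eq_sum]; positivity

theorem hsNormSq_conjTranspose (X : Matrix S S ℂ) : hsNormSq Xᴴ = hsNormSq X := by
  simp only [hsNormSq, Matrix.conjTranspose_conjTranspose, Matrix.trace_mul_comm X]

/-- Cauchy–Schwarz for the Hilbert–Schmidt inner product. -/
theorem re_trace_conjTranspose_mul_le (X Y : Matrix S S ℂ) :
    (Xᴴ * Y).trace.re ≤ √(hsNormSq X) * √(hsNormSq Y) := by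
  have h1 : (Xᴴ * Y).trace.re ≤ ∑ k : S × S, ‖X k.1 k.2‖ * ‖Y k.1 k.2‖ := by
    simp only [Matrix.trace, Matrix.diag, Matrix.mul_apply, Matrix.conjTranspose_apply,
      Complex.re_sum, Fintype.sum_prod_type]
    rw [Finset.sum_comm]
    refine Finset.sum_le_sum fun i _ => Finset.sum_le_sum fun j _ => ?_
    refine (Complex.re_le_norm _).trans ?_
    simp
  refine h1.trans ?_
  rw [hsNormSq_eq_sum, hsNormSq_eq_sum, ← Fintype.sum_prod_type', ← Fintype.sum_prod_type']
  exact Real.sum_mul_le_sqrt_mul_sqrt _ _ _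

theorem re_trace_conj_mono {M N : Matrix S S ℂ} (h : M ≤ N) (B : Matrix S S ℂ) :
    (Bᴴ * M * B).trace.re ≤ (Bᴴ * N * B).trace.re := by
  have := (h.conjTranspose_mul_mul_same B).trace_nonneg
  rw [Matrix.mul_sub, Matrix.sub_mul, Matrix.trace_sub] at this
  have := (Complex.le_def.1 this).1
  simp at this
  linarith

variable [DecidableEq S]

theorem hsNormSq_mul_le {c : ℝ} {Y : Matrix S S ℂ} (h : Yᴴ * Y ≤ c • (1 : Matrix S S ℂ))
    (B : Matrix S S ℂ) : hsNormSq (Y * B) ≤ c * hsNormSq B := by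
  have := re_trace_conj_mono h B
  simpa [hsNormSq, Matrix.mul_assoc] using this

theorem conjTranspose_sqrt (τ : Matrix S S ℂ) : (CFC.sqrt τ)ᴴ = CFC.sqrt τ :=
  (CFC.sqrt_nonneg τ).isSelfAdjoint

theorem hsNormSq_sqrt_of_posSemidef {τ : Matrix S S ℂ}
    (hτ : τ.PosSemidef) : hsNormSq (CFC.sqrt τ) = τ.trace.re := by
  rw [hsNormSq, conjTranspose_sqrt, CFC.sqrt_mul_sqrt_self _ (Matrix.nonneg_iff_posSemidef.2 hτ)]

/-- Polar decomposition with a partial isometry. -/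
theorem exists_polar (X : Matrix S S ℂ) : ∃ V : Matrix S S ℂ,
    Vᴴ * V ≤ 1 ∧ V * Vᴴ ≤ 1 ∧ X = V * CFC.abs X ∧ CFC.abs X = Vᴴ * X := by
  set a := CFC.abs X with ha
  have hsa : IsSelfAdjoint a := (CFC.abs_nonneg X).isSelfAdjoint
  have haa : a * a = Xᴴ * X := CFC.abs_mul_abs X
  have hc : ∀ f : ℝ → ℝ, ContinuousOn f (spectrum ℝ a) := fun f =>
    (Matrix.finite_real_spectrum (A := a)).continuousOn f
  -- the pseudo-inverse of `|X|`, since `0⁻¹ = 0`; the partial isometry is `X f`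
  set f := cfc (fun x : ℝ => x⁻¹) a with hf
  have hfs : fᴴ = f := (cfc_predicate (R := ℝ) _ a : IsSelfAdjoint _)
  have hid : cfc (fun x : ℝ => x) a = a := cfc_id' ℝ a
  have hfa : f * a = cfc (fun x : ℝ => x⁻¹ * x) a := by
    rw [cfc_mul _ _ a (hc _) (hc _), hid]
  have haf : a * f = f * a := by
    have := cfc_commute_cfc (fun x : ℝ => x) (fun x : ℝ => x⁻¹) a
    rwa [hid] at this
  have hfaf : f * a * f = f := by
    rw [hfa, hf, ← cfc_mul _ _ a (hc _) (hc _)]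
    refine cfc_congr fun x _ => ?_
    by_cases hx : x = 0 <;> simp [hx]
  have hafa : a * (f * a) = a := by
    rw [hfa]
    conv_lhs => enter [1]; rw [← hid]
    rw [← cfc_mul _ _ a (hc _) (hc _)]
    conv_rhs => rw [← hid]
    refine cfc_congr fun x _ => ?_
    by_cases hx : x = 0 <;> simp [hx]
  have hP1 : f * a ≤ 1 := by
    rw [hfa]
    refine cfc_le_one _ _ fun x _ => ?_
    by_cases hx : x = 0 <;> simp [hx]
  have hVV : (X * f)ᴴ * (X * f) = f * a := by
    calc (X * f)ᴴ * (X * f) = f * (Xᴴ * X) * f := by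
          rw [Matrix.conjTranspose_mul, hfs]; simp only [Matrix.mul_assoc]
      _ = f * (a * (a * f)) := by rw [← haa]; simp only [Matrix.mul_assoc]
      _ = f * a := by rw [haf, hafa]
  have hXP : X * (f * a) = X := by
    rw [← sub_eq_zero, ← Matrix.conjTranspose_mul_self_eq_zero]
    have hPs : (f * a)ᴴ = f * a := by
      rw [Matrix.conjTranspose_mul, hfs, show aᴴ = a from hsa, haf]
    have e : X * (f * a) - X = X * (f * a - 1) := by rw [Matrix.mul_sub, Matrix.mul_one]
    have e2 : a * (f * a - 1) = 0 := by rw [Matrix.mul_sub, hafa, Matrix.mul_one, sub_self]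
    rw [e, Matrix.conjTranspose_mul, Matrix.mul_assoc, ← Matrix.mul_assoc Xᴴ, ← haa,
      Matrix.mul_assoc a, e2, Matrix.mul_zero, Matrix.mul_zero]
  refine ⟨X * f, hVV ▸ hP1, ?_, ?_, ?_⟩
  · have hE : X * f * (X * f)ᴴ * (X * f * (X * f)ᴴ) = X * f * (X * f)ᴴ := by
      calc _ = X * f * ((X * f)ᴴ * (X * f)) * (X * f)ᴴ := by simp only [Matrix.mul_assoc]
        _ = X * (f * a * f) * (X * f)ᴴ := by rw [hVV, ← haf]; simp only [Matrix.mul_assoc, haf]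
        _ = _ := by rw [hfaf]
    have hEs : (X * f * (X * f)ᴴ)ᴴ = X * f * (X * f)ᴴ := by simp
    have : 1 - X * f * (X * f)ᴴ = (1 - X * f * (X * f)ᴴ)ᴴ * (1 - X * f * (X * f)ᴴ) := by
      rw [Matrix.conjTranspose_sub, hEs, Matrix.conjTranspose_one, Matrix.sub_mul, Matrix.one_mul,
        Matrix.mul_sub, hE, Matrix.mul_one, sub_self, sub_zero]
    rw [Matrix.le_iff, this]
    exact Matrix.posSemidef_conjTranspose_mul_self _
  · rw [Matrix.mul_assoc, hXP]
  · rw [Matrix.conjTranspose_mul, hfs, Matrix.mul_assoc, ← haa, ← Matrix.mul_assoc, ← haf,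
      Matrix.mul_assoc, hafa]

theorem traceNorm_nonneg (X : Matrix S S ℂ) : 0 ≤ traceNorm X := by
  have := (Matrix.nonneg_iff_posSemidef.1 (CFC.abs_nonneg X)).trace_nonneg
  exact (Complex.le_def.1 this).1

/-- Duality between the trace norm and the operator norm. -/
theorem re_trace_mul_le_traceNorm {c : ℝ} (hc : 0 ≤ c) {C : Matrix S S ℂ}
    (hC : Cᴴ * C ≤ c • (1 : Matrix S S ℂ)) (X : Matrix S S ℂ) :
    (Cᴴ * X).trace.re ≤ √c * traceNorm X := by
  obtain ⟨V, hV, -, hX, -⟩ := exists_polar X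
  set s := CFC.sqrt (CFC.abs X) with hs
  have hss : s * s = CFC.abs X := CFC.sqrt_mul_sqrt_self _ (CFC.abs_nonneg X)
  have hsh : sᴴ = s := conjTranspose_sqrt _
  have h1 : hsNormSq s = traceNorm X := by rw [hsNormSq, hsh, hss, traceNorm]
  have h2 : (Cᴴ * X).trace = ((C * s)ᴴ * (V * s)).trace := by
    conv_lhs => rw [hX, ← hss]
    rw [← Matrix.mul_assoc, ← Matrix.mul_assoc, Matrix.trace_mul_comm, Matrix.conjTranspose_mul,
      hsh]
    simp only [Matrix.mul_assoc]
  rw [h2]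
  refine (re_trace_conjTranspose_mul_le _ _).trans ?_
  have h3 : hsNormSq (V * s) ≤ traceNorm X := by
    simpa [h1] using hsNormSq_mul_le (c := 1) (by simpa using hV) s
  have h4 : hsNormSq (C * s) ≤ c * traceNorm X := by simpa [h1] using hsNormSq_mul_le hC s
  calc _ ≤ √(c * traceNorm X) * √(traceNorm X) := by gcongr
    _ = _ := by
      rw [Real.sqrt_mul hc, mul_assoc, Real.mul_self_sqrt (traceNorm_nonneg X)]

/-- Hölder's inequality for two Hilbert–Schmidt factors. -/
theorem traceNorm_conjTranspose_mul_le (X Y : Matrix S S ℂ) :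
    traceNorm (Xᴴ * Y) ≤ √(hsNormSq X) * √(hsNormSq Y) := by
  obtain ⟨V, -, hV, -, hX⟩ := exists_polar (Xᴴ * Y)
  have h : Vᴴ * (Xᴴ * Y) = (X * V)ᴴ * Y := by
    rw [Matrix.conjTranspose_mul, Matrix.mul_assoc]
  rw [traceNorm, hX, h]
  refine (re_trace_conjTranspose_mul_le _ _).trans ?_
  have : hsNormSq (X * V) ≤ hsNormSq X := by
    rw [← hsNormSq_conjTranspose, Matrix.conjTranspose_mul, ← hsNormSq_conjTranspose X]
    simpa using hsNormSq_mul_le (c := 1) (Y := Vᴴ) (by simpa using hV) Xᴴ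
  gcongr

theorem sqrt_conjTranspose_mul_self (G : Matrix S S ℂ) : CFC.sqrt (Gᴴ * G) = CFC.abs G := rfl

/-- Any square root `G` of `τ = G†G` gives a lower bound on the root fidelity. -/
theorem re_trace_mul_le_traceNorm_sqrt (G R : Matrix S S ℂ) :
    (G * R).trace.re ≤ traceNorm (CFC.sqrt (Gᴴ * G) * R) := by
  obtain ⟨V, -, hV, hG, -⟩ := exists_polar G
  have := re_trace_mul_le_traceNorm (c := 1) zero_le_one (C := Vᴴ) (by simpa using hV)
    (CFC.sqrt (Gᴴ * G) * R)
  rw [sqrt_conjTranspose_mul_self] at this ⊢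
  rw [Matrix.conjTranspose_conjTranspose, ← Matrix.mul_assoc, ← hG] at this
  simpa using this

/-- Hölder's inequality for `√τ C`, where `τ = G†G` has the square root `G = K†Z`. -/
theorem traceNorm_sqrt_mul_le (K Z C : Matrix S S ℂ) :
    traceNorm (CFC.sqrt ((Kᴴ * Z)ᴴ * (Kᴴ * Z)) * C) ≤ √(hsNormSq K) * √(hsNormSq (Z * C)) := by
  obtain ⟨V, -, hV, -, hG⟩ := exists_polar (Kᴴ * Z)
  have h : CFC.abs (Kᴴ * Z) * C = (K * V)ᴴ * (Z * C) := by
    rw [hG, Matrix.conjTranspose_mul]; simp only [Matrix.mul_assoc]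
  rw [sqrt_conjTranspose_mul_self, h]
  refine (traceNorm_conjTranspose_mul_le _ _).trans ?_
  have : hsNormSq (K * V) ≤ hsNormSq K := by
    rw [← hsNormSq_conjTranspose, Matrix.conjTranspose_mul, ← hsNormSq_conjTranspose K]
    simpa using hsNormSq_mul_le (c := 1) (Y := Vᴴ) (by simpa using hV) Kᴴ
  gcongr

/-- Perturbing the second factor changes the trace norm by at most a product of
Hilbert–Schmidt norms. -/
theorem traceNorm_mul_le_of_approx (T R L : Matrix S S ℂ) :
    traceNorm (T * R) ≤ traceNorm (T * L) + √(hsNormSq T) * √(hsNormSq (R - L)) := by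
  obtain ⟨V, hV', hV, -, hX⟩ := exists_polar (T * R)
  have h : Vᴴ * (T * R) = Vᴴ * (T * L) + (Tᴴ * V)ᴴ * (R - L) := by
    rw [Matrix.conjTranspose_mul, Matrix.conjTranspose_conjTranspose, Matrix.mul_sub]
    simp only [Matrix.mul_assoc]; abel
  have h1 : (Vᴴ * (T * L)).trace.re ≤ traceNorm (T * L) := by
    simpa using re_trace_mul_le_traceNorm (c := 1) zero_le_one (by simpa using hV') (T * L)
  rw [traceNorm, hX, h, Matrix.trace_add, Complex.add_re]
  refine add_le_add h1 ((re_trace_conjTranspose_mul_le _ _).trans ?_)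
  have : hsNormSq (Tᴴ * V) ≤ hsNormSq T := by
    rw [← hsNormSq_conjTranspose, Matrix.conjTranspose_mul, Matrix.conjTranspose_conjTranspose]
    simpa using hsNormSq_mul_le (c := 1) (Y := Vᴴ) (by simpa using hV) T
  gcongr

theorem traceNorm_mul_conjTranspose_le {c : ℝ} (hc : 0 ≤ c) {Y : Matrix S S ℂ}
    (hY : Yᴴ * Y ≤ c • (1 : Matrix S S ℂ)) (X : Matrix S S ℂ) :
    traceNorm (X * Yᴴ) ≤ √c * traceNorm X := by
  obtain ⟨V, hV, -, -, hX⟩ := exists_polar (X * Yᴴ)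
  have h : (Vᴴ * (X * Yᴴ)).trace = ((V * Y)ᴴ * X).trace := by
    rw [← Matrix.mul_assoc, Matrix.trace_mul_comm, Matrix.conjTranspose_mul, Matrix.mul_assoc]
  rw [traceNorm, hX, h]
  refine re_trace_mul_le_traceNorm hc (le_trans ?_ hY) X
  have := hV.conjTranspose_mul_mul_same Y
  rw [Matrix.le_iff]
  convert this using 1
  rw [Matrix.mul_sub, Matrix.sub_mul, Matrix.mul_one, Matrix.conjTranspose_mul]
  simp only [Matrix.mul_assoc]

end TraceNorm

/-! ### The pinching inequality -/

section Pinching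

variable {S : Type*} [Fintype S]

/-- Cauchy–Schwarz in operator form: the defect is half the sum of the Gram matrices of all
differences `N k - N l`. -/
theorem conjTranspose_sum_mul_sum_le {ι : Type*} (K : Finset ι) (N : ι → Matrix S S ℂ) :
    (∑ k ∈ K, N k)ᴴ * (∑ k ∈ K, N k) ≤ (K.card : ℝ) • ∑ k ∈ K, (N k)ᴴ * N k := by
  have key : ∑ k ∈ K, ∑ l ∈ K, (N k - N l)ᴴ * (N k - N l)
      = (2 : ℝ) • ((K.card : ℝ) • ∑ k ∈ K, (N k)ᴴ * N k
          - (∑ k ∈ K, N k)ᴴ * (∑ k ∈ K, N k)) := by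
    simp only [Matrix.conjTranspose_sub, Matrix.sub_mul, Matrix.mul_sub, Finset.sum_sub_distrib,
      Finset.sum_const, ← Finset.mul_sum, ← Finset.sum_mul, ← Matrix.conjTranspose_sum,
      ← Nat.cast_smul_eq_nsmul ℝ, ← Finset.smul_sum]
    module
  rw [Matrix.le_iff]
  have h2 : (K.card : ℝ) • ∑ k ∈ K, (N k)ᴴ * N k - (∑ k ∈ K, N k)ᴴ * (∑ k ∈ K, N k)
      = (2⁻¹ : ℝ) • ∑ k ∈ K, ∑ l ∈ K, (N k - N l)ᴴ * (N k - N l) := by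
    rw [key, smul_smul]; norm_num
  rw [h2]
  refine Matrix.PosSemidef.smul ?_ (by norm_num)
  exact Matrix.posSemidef_sum _ fun k _ => Matrix.posSemidef_sum _ fun l _ =>
    Matrix.posSemidef_conjTranspose_mul_self _

/-- The Gram matrix `W† g W` with its entries restricted to the blocks on which `c` is constant,
the weight `g` of a row being allowed to depend on the block. -/
noncomputable def pinchedGram (c : S → ℝ) (W : Matrix S S ℂ) (g : S → ℝ → ℝ) : Matrix S S ℂ :=
  Matrix.of fun j j' => if c j = c j' then ∑ i, star (W i j) * (g i (c j) : ℂ) * W i j' else 0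

/-- The columns of `W` with label `k`, the rows being multiplied by `w · k`. -/
noncomputable def columnBlock (c : S → ℝ) (W : Matrix S S ℂ) (w : S → ℝ → ℝ) (k : ℝ) :
    Matrix S S ℂ :=
  Matrix.of fun i j => if c j = k then (w i k : ℂ) * W i j else 0

theorem sum_gram_columnBlock (c : S → ℝ) (W : Matrix S S ℂ) (w : S → ℝ → ℝ) :
    ∑ k ∈ Finset.univ.image c, (columnBlock c W w k)ᴴ * columnBlock c W w k
      = pinchedGram c W fun i k => w i k ^ 2 := by
  ext j j'
  simp only [Matrix.sum_apply, Matrix.mul_apply, Matrix.conjTranspose_apply, columnBlock,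
    pinchedGram, Matrix.of_apply]
  rw [Finset.sum_eq_single (c j)]
  · by_cases h : c j = c j'
    · simp only [h, if_true]
      refine Finset.sum_congr rfl fun i _ => ?_
      simp
      ring
    · simp [h, Ne.symm h]
  · intro k _ hk
    simp [Ne.symm hk]
  · intro h
    exact absurd (Finset.mem_image_of_mem c (Finset.mem_univ j)) h

theorem pinchedGram_mono (c : S → ℝ) (W : Matrix S S ℂ) {g g' : S → ℝ → ℝ}
    (h : ∀ i j, g i (c j) ≤ g' i (c j)) : pinchedGram c W g ≤ pinchedGram c W g' := by
  have : pinchedGram c W g' - pinchedGram c W g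
      = pinchedGram c W fun i k => √(g' i k - g i k) ^ 2 := by
    ext j j'
    simp only [pinchedGram, Matrix.sub_apply, Matrix.of_apply]
    split_ifs
    · rw [← Finset.sum_sub_distrib]
      refine Finset.sum_congr rfl fun i _ => ?_
      rw [Real.sq_sqrt (sub_nonneg.2 (h i j))]
      push_cast
      ring
    · simp
  rw [Matrix.le_iff, this, ← sum_gram_columnBlock]
  exact Matrix.posSemidef_sum _ fun k _ => Matrix.posSemidef_conjTranspose_mul_self _

/-- The pinching inequality for a matrix `N` obtained from `W` by a multiplier that depends on the
column through its label `c j` only: the number of labels bounds the loss. -/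
theorem gram_le_card_smul_pinchedGram (c : S → ℝ) (W : Matrix S S ℂ) {m g : S → ℝ → ℝ}
    (h : ∀ i j, m i (c j) ^ 2 ≤ g i (c j)) {N : Matrix S S ℂ}
    (hN : ∀ i j, N i j = (m i (c j) : ℂ) * W i j) :
    Nᴴ * N ≤ ((Finset.univ.image c).card : ℝ) • pinchedGram c W g := by
  have hsum : N = ∑ k ∈ Finset.univ.image c, columnBlock c W m k := by
    ext i j
    rw [Matrix.sum_apply, Finset.sum_eq_single (c j)]
    · simp [columnBlock, hN]
    · intro k _ hk
      simp [columnBlock, Ne.symm hk]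
    · intro h
      exact absurd (Finset.mem_image_of_mem c (Finset.mem_univ j)) h
  have h1 := conjTranspose_sum_mul_sum_le (Finset.univ.image c) (columnBlock c W m)
  rw [← hsum, sum_gram_columnBlock] at h1
  refine h1.trans ?_
  have h2 := pinchedGram_mono c W (g := fun i k => m i k ^ 2) (g' := g) h
  rw [Matrix.le_iff] at h2 ⊢
  rw [← smul_sub]
  exact h2.smul (Nat.cast_nonneg _)

theorem pinchedGram_const [DecidableEq S] (c : S → ℝ) {W : Matrix S S ℂ} (hW : Wᴴ * W = 1)
    (l : ℝ) : pinchedGram c W (fun _ _ => l) = l • (1 : Matrix S S ℂ) := by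
  ext j j'
  have : (Wᴴ * W) j j' = (1 : Matrix S S ℂ) j j' := by rw [hW]
  rw [Matrix.smul_apply, ← this]
  simp only [pinchedGram, Matrix.of_apply]
  split_ifs with h
  · simp only [Matrix.mul_apply, Matrix.conjTranspose_apply, Finset.smul_sum]
    refine Finset.sum_congr rfl fun i _ => ?_
    simp only [Complex.real_smul]
    ring
  · rw [this, Matrix.one_apply_ne (fun e => h (congrArg c e)), smul_zero]

end Pinching

/-! ### Spectral data and masked operators -/

section OneShot

variable {A B : Type*} [Fintype A] [Fintype B]

theorem trace_partialTraceLeft (ρ : Matrix (A × B) (A × B) ℂ) :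
    (partialTraceLeft ρ).trace = ρ.trace := by
  simp only [Matrix.trace, Matrix.diag, partialTraceLeft, Matrix.of_apply, Fintype.sum_prod_type]
  exact Finset.sum_comm

variable [DecidableEq A]

theorem partialTraceLeft_conj_one_kronecker (ρ : Matrix (A × B) (A × B) ℂ) (V : Matrix B B ℂ) :
    partialTraceLeft (((1 : Matrix A A ℂ) ⊗ₖ V)ᴴ * ρ * ((1 : Matrix A A ℂ) ⊗ₖ V))
      = Vᴴ * partialTraceLeft ρ * V := by
  ext j j'
  simp only [partialTraceLeft, Matrix.of_apply, Matrix.mul_apply, Matrix.conjTranspose_apply,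
    Fintype.sum_prod_type, Matrix.kroneckerMap_apply, Matrix.one_apply, Finset.sum_mul,
    Finset.mul_sum]
  simp only [ite_mul, one_mul, zero_mul, apply_ite star, star_zero, mul_ite, mul_zero,
    Finset.sum_ite_irrel, Finset.sum_const_zero, Finset.sum_ite_eq', Finset.mem_univ, if_true]
  rw [Finset.sum_comm]
  refine Finset.sum_congr rfl fun b _ => ?_
  rw [Finset.sum_comm]

variable [DecidableEq B]

theorem sqrt_conj_diagonal {S : Type*} [Fintype S] [DecidableEq S] {U : Matrix S S ℂ}
    (hU : Uᴴ * U = 1) {p : S → ℝ} (hp : ∀ i, 0 ≤ p i) :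
    CFC.sqrt (U * Matrix.diagonal (fun i => (p i : ℂ)) * Uᴴ)
      = U * Matrix.diagonal (fun i => (√(p i) : ℂ)) * Uᴴ := by
  refine CFC.sqrt_unique ?_ ?_
  · have : ∀ D : Matrix S S ℂ, U * D * Uᴴ * (U * D * Uᴴ) = U * (D * (Uᴴ * U) * D) * Uᴴ := by
      intro D; simp only [Matrix.mul_assoc]
    rw [this, hU, Matrix.mul_one, Matrix.diagonal_mul_diagonal]
    congr 3
    ext i
    rw [← Complex.ofReal_mul, Real.mul_self_sqrt (hp i)]
  · rw [Matrix.nonneg_iff_posSemidef]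
    refine Matrix.PosSemidef.mul_mul_conjTranspose_same (Matrix.PosSemidef.diagonal ?_) U
    intro i
    simp [Real.sqrt_nonneg]

/-- Spectral decompositions `ρ_AB = U diag(p) U†` of a state and `ρ_B = V diag(q) V†` of its
marginal: `U` and `V` are unitary, and the eigenvalues `p`, `q` are listed with multiplicity, in any
order. -/
structure SpectralData (ρ : Matrix (A × B) (A × B) ℂ) where
  U : Matrix (A × B) (A × B) ℂ
  V : Matrix B B ℂ
  p : A × B → ℝ
  q : B → ℝ
  U_left : Uᴴ * U = 1
  U_right : U * Uᴴ = 1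
  V_left : Vᴴ * V = 1
  V_right : V * Vᴴ = 1
  p_nonneg : ∀ i, 0 ≤ p i
  q_nonneg : ∀ j, 0 ≤ q j
  sum_p : ∑ i, p i = 1
  eq_joint : ρ = U * Matrix.diagonal (fun i => (p i : ℂ)) * Uᴴ
  eq_marginal : partialTraceLeft ρ = V * Matrix.diagonal (fun j => (q j : ℂ)) * Vᴴ

namespace SpectralData

variable {ρ : Matrix (A × B) (A × B) ℂ} (s : SpectralData ρ)

/-- The basis change to `A` tensored with the eigenbasis of the marginal. -/
noncomputable def E : Matrix (A × B) (A × B) ℂ := (1 : Matrix A A ℂ) ⊗ₖ s.V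

theorem E_left : s.Eᴴ * s.E = 1 := by
  rw [E, Matrix.conjTranspose_kronecker, ← Matrix.mul_kronecker_mul, s.V_left,
    Matrix.conjTranspose_one, Matrix.mul_one, Matrix.one_kronecker_one]

theorem E_right : s.E * s.Eᴴ = 1 := by
  rw [E, Matrix.conjTranspose_kronecker, ← Matrix.mul_kronecker_mul, s.V_right,
    Matrix.conjTranspose_one, Matrix.mul_one, Matrix.one_kronecker_one]

/-- The overlaps of the eigenvectors of `ρ_AB` with those of `1 ⊗ ρ_B`. -/
noncomputable def W : Matrix (A × B) (A × B) ℂ := s.Uᴴ * s.E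

theorem W_left : s.Wᴴ * s.W = 1 := by
  rw [W, Matrix.conjTranspose_mul, Matrix.conjTranspose_conjTranspose, Matrix.mul_assoc,
    ← Matrix.mul_assoc s.U, s.U_right, Matrix.one_mul, s.E_left]

theorem W_right : s.W * s.Wᴴ = 1 := by
  rw [W, Matrix.conjTranspose_mul, Matrix.conjTranspose_conjTranspose, Matrix.mul_assoc,
    ← Matrix.mul_assoc s.E, s.E_right, Matrix.one_mul, s.U_left]

/-- The Nussbaum–Szkoła distribution of `ρ_AB` and `1 ⊗ ρ_B`. -/
noncomputable def weight (i j : A × B) : ℝ := s.p i * ‖s.W i j‖ ^ 2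

theorem weight_nonneg (i j : A × B) : 0 ≤ s.weight i j :=
  mul_nonneg (s.p_nonneg i) (sq_nonneg _)

theorem sum_weight_right (i : A × B) : ∑ j, s.weight i j = s.p i := by
  have h : (s.W * s.Wᴴ) i i = 1 := by rw [s.W_right, Matrix.one_apply_eq]
  simp only [Matrix.mul_apply, Matrix.conjTranspose_apply, RCLike.star_def, Complex.mul_conj']
    at h
  simp only [weight, ← Finset.mul_sum]
  rw [show ∑ j, ‖s.W i j‖ ^ 2 = 1 by exact_mod_cast h, mul_one]

open Classical in
/-- The total weight of the pairs of eigenvalues in `T`. -/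
noncomputable def mass (T : Set (ℝ × ℝ)) : ℝ :=
  ∑ i, ∑ j, if (s.p i, s.q j.2) ∈ T then s.weight i j else 0

theorem mass_nonneg (T : Set (ℝ × ℝ)) : 0 ≤ s.mass T := by
  refine Finset.sum_nonneg fun i _ => Finset.sum_nonneg fun j _ => ?_
  split_ifs
  exacts [s.weight_nonneg i j, le_rfl]

theorem mass_add_mass_compl (T : Set (ℝ × ℝ)) : s.mass T + s.mass Tᶜ = 1 := by
  rw [mass, mass, ← Finset.sum_add_distrib, ← s.sum_p]
  refine Finset.sum_congr rfl fun i _ => ?_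
  refine Eq.trans ?_ (s.sum_weight_right i)
  rw [← Finset.sum_add_distrib]
  refine Finset.sum_congr rfl fun j _ => ?_
  by_cases h : (s.p i, s.q j.2) ∈ T <;> simp [h]

open Classical in
/-- The identity with only those matrix elements, between an eigenvector of `ρ_AB` and one of
`1 ⊗ ρ_B`, kept whose eigenvalues form a pair in `T`. -/
noncomputable def maskedOne (T : Set (ℝ × ℝ)) : Matrix (A × B) (A × B) ℂ :=
  s.U * (Matrix.of fun i j => if (s.p i, s.q j.2) ∈ T then s.W i j else 0) * s.Eᴴ

theorem one_sub_maskedOne (T : Set (ℝ × ℝ)) : 1 - s.maskedOne T = s.maskedOne Tᶜ := by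
  have h : (1 : Matrix (A × B) (A × B) ℂ) = s.U * s.W * s.Eᴴ := by
    rw [W, ← Matrix.mul_assoc, s.U_right, Matrix.one_mul, s.E_right]
  rw [h, maskedOne, maskedOne, ← Matrix.sub_mul, ← Matrix.mul_sub]
  congr 2
  ext i j
  by_cases h : (s.p i, s.q j.2) ∈ T <;> simp [h]

theorem sqrt_eq : CFC.sqrt ρ = s.U * Matrix.diagonal (fun i => (√(s.p i) : ℂ)) * s.Uᴴ := by
  conv_lhs => rw [s.eq_joint]
  exact sqrt_conj_diagonal s.U_left s.p_nonneg

theorem posSemidef (s : SpectralData ρ) : ρ.PosSemidef := by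
  rw [s.eq_joint]
  refine Matrix.PosSemidef.mul_mul_conjTranspose_same (Matrix.PosSemidef.diagonal ?_) _
  intro i
  simp [s.p_nonneg]

theorem trace_eq_one (s : SpectralData ρ) : ρ.trace = 1 := by
  rw [s.eq_joint, Matrix.trace_mul_comm, ← Matrix.mul_assoc, s.U_left, Matrix.one_mul,
    Matrix.trace_diagonal, ← Complex.ofReal_sum, s.sum_p, Complex.ofReal_one]

theorem hsNormSq_sqrt (s : SpectralData ρ) : hsNormSq (CFC.sqrt ρ) = 1 := by
  rw [hsNormSq_sqrt_of_posSemidef s.posSemidef, s.trace_eq_one, Complex.one_re]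

theorem hsNormSq_conj (N : Matrix (A × B) (A × B) ℂ) : hsNormSq (s.U * N * s.Eᴴ) = hsNormSq N := by
  have : (s.U * N * s.Eᴴ)ᴴ * (s.U * N * s.Eᴴ) = s.E * (Nᴴ * N) * s.Eᴴ := by
    simp only [Matrix.conjTranspose_mul, Matrix.conjTranspose_conjTranspose, Matrix.mul_assoc]
    rw [← Matrix.mul_assoc s.Uᴴ, s.U_left, Matrix.one_mul]
  rw [hsNormSq, this, Matrix.trace_mul_comm, ← Matrix.mul_assoc, s.E_left, Matrix.one_mul, hsNormSq]

open Classical in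
theorem sqrt_mul_maskedOne (T : Set (ℝ × ℝ)) : CFC.sqrt ρ * s.maskedOne T
    = s.U * (Matrix.of fun i j =>
        if (s.p i, s.q j.2) ∈ T then (√(s.p i) : ℂ) * s.W i j else 0) * s.Eᴴ := by
  rw [s.sqrt_eq, maskedOne]
  simp only [Matrix.mul_assoc]
  rw [← Matrix.mul_assoc s.Uᴴ, s.U_left, Matrix.one_mul, ← Matrix.mul_assoc (Matrix.diagonal _)]
  congr 2
  ext i j
  simp [Matrix.diagonal_mul]

theorem hsNormSq_sqrt_mul_maskedOne (T : Set (ℝ × ℝ)) :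
    hsNormSq (CFC.sqrt ρ * s.maskedOne T) = s.mass T := by
  rw [s.sqrt_mul_maskedOne, hsNormSq_conj, hsNormSq_eq_sum, mass]
  refine Finset.sum_congr rfl fun i _ => Finset.sum_congr rfl fun j _ => ?_
  by_cases h : (s.p i, s.q j.2) ∈ T
  · simp [h, weight, mul_pow, abs_of_nonneg (Real.sqrt_nonneg _), Real.sq_sqrt (s.p_nonneg i)]
  · simp [h]

theorem re_trace_sqrt_mul_maskedOne_mul_sqrt (T : Set (ℝ × ℝ)) :
    (CFC.sqrt ρ * s.maskedOne T * CFC.sqrt ρ).trace.re = s.mass T := by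
  have hE : s.Eᴴ * s.U = s.Wᴴ := by
    rw [W, Matrix.conjTranspose_mul, Matrix.conjTranspose_conjTranspose]
  rw [s.sqrt_mul_maskedOne, s.sqrt_eq]
  simp only [Matrix.mul_assoc]
  rw [Matrix.trace_mul_comm]
  simp only [Matrix.mul_assoc]
  rw [s.U_left, Matrix.mul_one, ← Matrix.mul_assoc s.Eᴴ, hE, mass, Matrix.trace]
  simp only [Matrix.diag, Matrix.mul_apply, Matrix.diagonal_apply, mul_ite, mul_zero,
    Finset.sum_ite_eq', Finset.mem_univ, Complex.re_sum, Matrix.of_apply,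
    Matrix.conjTranspose_apply]
  refine Finset.sum_congr rfl fun i _ => Finset.sum_congr rfl fun j _ => ?_
  by_cases h : (s.p i, s.q j.2) ∈ T
  · simp only [h, if_true, weight]
    have : (√(s.p i) : ℂ) * s.W i j * (star (s.W i j) * (√(s.p i) : ℂ))
        = ((√(s.p i) * √(s.p i) * ‖s.W i j‖ ^ 2 : ℝ) : ℂ) := by
      push_cast
      rw [← Complex.mul_conj', RCLike.star_def]
      ring
    rw [this, Complex.ofReal_re, Real.mul_self_sqrt (s.p_nonneg i)]
  · simp [h]

/-- The number of distinct eigenvalues of the marginal. -/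
noncomputable def numEigenvalues : ℕ := (Finset.univ.image fun j : A × B => s.q j.2).card

/-- Pairs of eigenvalues `(p, q)` with `p ≤ l q`. -/
def leSet (l : ℝ) : Set (ℝ × ℝ) := {x | x.1 ≤ l * x.2}

/-- Pairs of eigenvalues `(p, q)` with `0 < q ≤ l p`. -/
def geSet (l : ℝ) : Set (ℝ × ℝ) := {x | 0 < x.2 ∧ x.2 ≤ l * x.1}

theorem sqrt_one_kronecker_marginal :
    CFC.sqrt ((1 : Matrix A A ℂ) ⊗ₖ partialTraceLeft ρ)
      = s.E * Matrix.diagonal (fun j => (√(s.q j.2) : ℂ)) * s.Eᴴ := by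
  have : (1 : Matrix A A ℂ) ⊗ₖ partialTraceLeft ρ
      = s.E * Matrix.diagonal (fun j => (s.q j.2 : ℂ)) * s.Eᴴ := by
    have hd : Matrix.diagonal (fun j : A × B => (s.q j.2 : ℂ))
        = (1 : Matrix A A ℂ) ⊗ₖ Matrix.diagonal (fun j => (s.q j : ℂ)) := by
      rw [← Matrix.diagonal_one, Matrix.diagonal_kronecker_diagonal]
      simp
    rw [hd, s.eq_marginal, E, Matrix.conjTranspose_kronecker, ← Matrix.mul_kronecker_mul,
      ← Matrix.mul_kronecker_mul, Matrix.one_mul, Matrix.conjTranspose_one, Matrix.mul_one]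
  rw [this]
  exact sqrt_conj_diagonal s.E_left fun j => s.q_nonneg j.2

/-- Where `p ≤ l q`, the masked square root of `ρ_AB` is a bounded multiple of `√(1 ⊗ ρ_B)`. -/
theorem exists_bounded_factor {l : ℝ} (hl : 0 ≤ l) : ∃ Y : Matrix (A × B) (A × B) ℂ,
    Yᴴ * Y ≤ (s.numEigenvalues * l) • (1 : Matrix (A × B) (A × B) ℂ) ∧
    CFC.sqrt ρ * s.maskedOne (leSet l)
      = Y * CFC.sqrt ((1 : Matrix A A ℂ) ⊗ₖ partialTraceLeft ρ) := by
  classical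
  -- the multiplier turning `W` into `Y`; at a zero eigenvalue `k` the masked `p i` vanishes too
  set m : A × B → ℝ → ℝ := fun i k => if s.p i ≤ l * k then √(s.p i) / √k else 0 with hm
  set N : Matrix (A × B) (A × B) ℂ :=
    Matrix.of fun i j => (m i (s.q j.2) : ℂ) * s.W i j with hN
  refine ⟨s.U * N * s.Eᴴ, ?_, ?_⟩
  · have h := gram_le_card_smul_pinchedGram (fun j : A × B => s.q j.2) s.W (m := m)
      (g := fun _ _ => l) (N := N) ?_ (fun i j => rfl)
    · rw [pinchedGram_const _ s.W_left, smul_smul] at h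
      have e : (s.U * N * s.Eᴴ)ᴴ * (s.U * N * s.Eᴴ) = s.E * (Nᴴ * N) * s.Eᴴ := by
        simp only [Matrix.conjTranspose_mul, Matrix.conjTranspose_conjTranspose, Matrix.mul_assoc]
        rw [← Matrix.mul_assoc s.Uᴴ, s.U_left, Matrix.one_mul]
      have h' := h.mul_mul_conjTranspose_same s.E
      rw [Matrix.le_iff, e]
      convert h' using 1
      rw [Matrix.mul_sub, Matrix.sub_mul, Matrix.mul_smul, Matrix.mul_one, Matrix.smul_mul,
        s.E_right]
      rfl
    · intro i j
      simp only [hm]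
      split_ifs with h
      · rw [div_pow, Real.sq_sqrt (s.p_nonneg i), Real.sq_sqrt (s.q_nonneg j.2)]
        rcases (s.q_nonneg j.2).eq_or_lt with h0 | h0
        · simp [← h0, hl]
        · rwa [div_le_iff₀ h0]
      · simpa using hl
  · rw [s.sqrt_one_kronecker_marginal, s.sqrt_mul_maskedOne]
    simp only [Matrix.mul_assoc]
    rw [← Matrix.mul_assoc s.Eᴴ, s.E_left, Matrix.one_mul, ← Matrix.mul_assoc N]
    congr 2
    ext i j
    simp only [Matrix.mul_diagonal, hN, hm, Matrix.of_apply]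
    by_cases h : s.p i ≤ l * s.q j.2
    · rw [if_pos (show (s.p i, s.q j.2) ∈ leSet l from h), if_pos h]
      rcases (s.q_nonneg j.2).eq_or_lt with h0 | h0
      · have : s.p i = 0 := le_antisymm (by simpa [← h0] using h) (s.p_nonneg i)
        simp [this]
      · have h1 : (√(s.q j.2) : ℂ) ≠ 0 := by
          exact_mod_cast (Real.sqrt_pos.2 h0).ne'
        push_cast
        field_simp
    · rw [if_neg (show (s.p i, s.q j.2) ∉ leSet l from h), if_neg h]
      simp

/-- The matrix of `ρ_B = tr_A ρ_AB` in its eigenbasis, expressed through the overlaps. -/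
theorem sum_overlap (j j' : B) :
    ∑ a, ∑ i, star (s.W i (a, j)) * (s.p i : ℂ) * s.W i (a, j')
      = if j = j' then (s.q j : ℂ) else 0 := by
  have : partialTraceLeft (s.Wᴴ * Matrix.diagonal (fun i => (s.p i : ℂ)) * s.W)
      = Matrix.diagonal (fun j => (s.q j : ℂ)) := by
    have e : s.Wᴴ * Matrix.diagonal (fun i => (s.p i : ℂ)) * s.W = s.Eᴴ * ρ * s.E := by
      rw [show s.Eᴴ * ρ * s.E = s.Eᴴ * _ * s.E from
        congrArg (fun X => s.Eᴴ * X * s.E) s.eq_joint,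
        W, Matrix.conjTranspose_mul, Matrix.conjTranspose_conjTranspose]
      simp only [Matrix.mul_assoc]
    rw [e, E, partialTraceLeft_conj_one_kronecker, s.eq_marginal]
    simp only [Matrix.mul_assoc]
    rw [s.V_left, Matrix.mul_one, ← Matrix.mul_assoc, s.V_left, Matrix.one_mul]
  have := congrFun (congrFun this j) j'
  rw [Matrix.diagonal_apply] at this
  rw [← this]
  simp [partialTraceLeft, Matrix.mul_apply, Matrix.diagonal_apply]

/-- Where `q ≤ l p`, the masked identity `Z` satisfies `tr_A Z†Z ≤ v l`, with `v` the number of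
distinct eigenvalues of the marginal. -/
theorem hsNormSq_maskedOne_mul_le {l : ℝ} (hl : 0 ≤ l) {σ : Matrix B B ℂ}
    (hσ : IsSubnormalized σ) {C : Matrix (A × B) (A × B) ℂ}
    (hC : C * Cᴴ = (1 : Matrix A A ℂ) ⊗ₖ σ) :
    hsNormSq (s.maskedOne (geSet l) * C) ≤ s.numEigenvalues * l := by
  classical
  set m : A × B → ℝ → ℝ := fun i k => if 0 < k ∧ k ≤ l * s.p i then 1 else 0 with hm
  -- this weight dominates the mask, and its pinched Gram matrix is a rescaled pinching of `ρ`;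
  -- at `k = 0` both the weight (by `l / 0 = 0`) and the mask vanish
  set g : A × B → ℝ → ℝ := fun i k => l / k * s.p i with hg
  set N : Matrix (A × B) (A × B) ℂ :=
    Matrix.of fun i j => if (s.p i, s.q j.2) ∈ geSet l then s.W i j else 0 with hN
  set M := pinchedGram (fun j : A × B => s.q j.2) s.W g with hM
  have h := gram_le_card_smul_pinchedGram (fun j : A × B => s.q j.2) s.W (m := m)
    (g := g) (N := N) ?_ ?_
  rotate_left
  · intro i j
    simp only [hm, hg]
    split_ifs with h
    · rw [div_mul_eq_mul_div, one_pow, one_le_div h.1]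
      exact h.2
    · have := s.p_nonneg i
      have := s.q_nonneg j.2
      rw [zero_pow two_ne_zero]
      positivity
  · intro i j
    simp only [hN, hm, Matrix.of_apply]
    by_cases h : 0 < s.q j.2 ∧ s.q j.2 ≤ l * s.p i
    · rw [if_pos (show (s.p i, s.q j.2) ∈ geSet l from h), if_pos h]
      simp
    · rw [if_neg (show (s.p i, s.q j.2) ∉ geSet l from h), if_neg h]
      simp
  have h1 := re_trace_conj_mono h (s.Eᴴ * C)
  have e1 : hsNormSq (s.maskedOne (geSet l) * C)
      = ((s.Eᴴ * C)ᴴ * (Nᴴ * N) * (s.Eᴴ * C)).trace.re := by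
    rw [hsNormSq, maskedOne]
    simp only [Matrix.conjTranspose_mul, Matrix.conjTranspose_conjTranspose, Matrix.mul_assoc]
    rw [← Matrix.mul_assoc s.Uᴴ, s.U_left, Matrix.one_mul]
  rw [e1]
  refine h1.trans ?_
  rw [Matrix.mul_smul, Matrix.smul_mul, Matrix.trace_smul, Complex.smul_re, smul_eq_mul]
  refine mul_le_mul_of_nonneg_left ?_ (Nat.cast_nonneg _)
  set τ := s.Vᴴ * σ * s.V with hτ
  have hτp : τ.PosSemidef := hσ.1.conjTranspose_mul_mul_same s.V
  have e2 : s.Eᴴ * C * (s.Eᴴ * C)ᴴ = (1 : Matrix A A ℂ) ⊗ₖ τ := by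
    rw [Matrix.conjTranspose_mul, Matrix.conjTranspose_conjTranspose, Matrix.mul_assoc,
      ← Matrix.mul_assoc C, hC, E, Matrix.conjTranspose_kronecker, ← Matrix.mul_kronecker_mul,
      ← Matrix.mul_kronecker_mul, Matrix.one_mul, Matrix.conjTranspose_one, Matrix.mul_one, hτ,
      Matrix.mul_assoc]
  rw [Matrix.trace_mul_comm, ← Matrix.mul_assoc, e2]
  -- tracing out `A` leaves `q j` on the diagonal, which cancels the factor `1 / q j` of `g`
  have e4 : (((1 : Matrix A A ℂ) ⊗ₖ τ) * M).trace
      = ∑ j, ((if s.q j = 0 then 0 else l : ℝ) : ℂ) * τ j j := by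
    have : (((1 : Matrix A A ℂ) ⊗ₖ τ) * M).trace = ∑ j', ∑ j, τ j' j *
        (if s.q j = s.q j' then ((l / s.q j : ℝ) : ℂ) *
          ∑ a, ∑ i, star (s.W i (a, j)) * (s.p i : ℂ) * s.W i (a, j') else 0) := by
      simp only [Matrix.trace, Matrix.diag, Matrix.mul_apply, Fintype.sum_prod_type,
        Matrix.kroneckerMap_apply, Matrix.one_apply, ite_mul, one_mul, zero_mul,
        Finset.sum_ite_irrel, Finset.sum_const_zero, Finset.sum_ite_eq, Finset.mem_univ, if_true]
      rw [Finset.sum_comm]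
      refine Finset.sum_congr rfl fun j' _ => ?_
      rw [Finset.sum_comm]
      refine Finset.sum_congr rfl fun j _ => ?_
      simp only [hM, pinchedGram, Matrix.of_apply, hg]
      split_ifs with hq
      · rw [← Finset.mul_sum, Finset.mul_sum (s := Finset.univ) (a := ((l / s.q j : ℝ) : ℂ))]
        congr 1
        refine Finset.sum_congr rfl fun a _ => ?_
        rw [← Fintype.sum_prod_type', Finset.mul_sum]
        refine Finset.sum_congr rfl fun i _ => ?_
        push_cast
        ring
      · simp
    rw [this]
    refine Finset.sum_congr rfl fun j' _ => ?_
    rw [Finset.sum_eq_single j']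
    · rw [s.sum_overlap, if_pos rfl, if_pos rfl, mul_comm]
      split_ifs with h0
      · simp [h0]
      · have : (s.q j' : ℂ) ≠ 0 := by exact_mod_cast h0
        push_cast
        field_simp
    · intro j _ hj
      rw [s.sum_overlap, if_neg hj]
      simp
    · simp
  rw [e4, Complex.re_sum]
  have e5 : ∑ j, (τ j j).re ≤ 1 := by
    have : τ.trace = σ.trace := by
      rw [hτ, Matrix.trace_mul_comm, ← Matrix.mul_assoc, s.V_right, Matrix.one_mul]
    have h2 := hσ.2
    rw [← this, Matrix.trace, Complex.re_sum] at h2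
    exact h2
  calc _ ≤ ∑ j, l * (τ j j).re := by
        refine Finset.sum_le_sum fun j _ => ?_
        rw [Complex.re_ofReal_mul]
        have : 0 ≤ (τ j j).re := (Complex.le_def.1 (hτp.diag_nonneg (i := j))).1
        split_ifs
        · simpa using mul_nonneg hl this
        · exact le_rfl
    _ ≤ l := by
        rw [← Finset.mul_sum]
        exact mul_le_of_le_one_right hl e5

end SpectralData

end OneShot

/-! ### One-shot bounds on the smooth entropies -/

section OneShotEntropy

variable {A B : Type*} [Fintype A] [DecidableEq A] [Fintype B] [DecidableEq B]

theorem elogb_mono {b x y : ℝ} (hb : 1 < b) (hx : 0 ≤ x) (hxy : x ≤ y) : elogb b x ≤ elogb b y := by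
  rcases hx.eq_or_lt with h | h
  · simp [elogb, ← h]
  · rw [elogb, elogb, if_neg h.ne', if_neg (h.trans_le hxy).ne', EReal.coe_le_coe_iff]
    exact Real.logb_le_logb_of_le hb h hxy

namespace SpectralData

variable {ρ : Matrix (A × B) (A × B) ℂ} (s : SpectralData ρ)

theorem numEigenvalues_pos : 0 < s.numEigenvalues := by
  have : Nonempty (A × B) := by
    by_contra h
    rw [not_nonempty_iff] at h
    simpa using s.sum_p
  exact Finset.card_pos.2 (Finset.univ_nonempty.image _)

theorem isSubnormalized_marginal (s : SpectralData ρ) : IsSubnormalized (partialTraceLeft ρ) := by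
  constructor
  · rw [s.eq_marginal]
    refine Matrix.PosSemidef.mul_mul_conjTranspose_same (Matrix.PosSemidef.diagonal ?_) _
    intro i
    simp [s.q_nonneg]
  · rw [trace_partialTraceLeft, s.trace_eq_one, Complex.one_re]

theorem genFidelity_eq (s : SpectralData ρ) (τ : Matrix (A × B) (A × B) ℂ) :
    genFidelity τ ρ = traceNorm (CFC.sqrt τ * CFC.sqrt ρ) ^ 2 := by
  simp [genFidelity, s.trace_eq_one]

/-- The smoothing `Z† ρ Z` of `ρ`, for the masked identity `Z` on the pairs in `T`. -/
noncomputable def smoothed (T : Set (ℝ × ℝ)) : Matrix (A × B) (A × B) ℂ :=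
  (CFC.sqrt ρ * s.maskedOne T)ᴴ * (CFC.sqrt ρ * s.maskedOne T)

theorem smoothed_mem_epsBall {T : Set (ℝ × ℝ)} {ε : ℝ} (hε : 0 ≤ ε)
    (h : 2 * s.mass Tᶜ ≤ ε ^ 2) : s.smoothed T ∈ epsBall ε ρ := by
  have hT := s.mass_add_mass_compl T
  have h0 := s.mass_nonneg T
  have h0' := s.mass_nonneg Tᶜ
  refine ⟨⟨Matrix.posSemidef_conjTranspose_mul_self _, ?_⟩, ?_⟩
  · have : (s.smoothed T).trace.re = s.mass T := s.hsNormSq_sqrt_mul_maskedOne T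
    linarith
  · rw [purifiedDistance, Real.sqrt_le_left hε, s.genFidelity_eq]
    have h1 : s.mass T ≤ traceNorm (CFC.sqrt (s.smoothed T) * CFC.sqrt ρ) := by
      rw [← s.re_trace_sqrt_mul_maskedOne_mul_sqrt]
      exact re_trace_mul_le_traceNorm_sqrt _ _
    have h2 : s.mass T ^ 2 ≤ traceNorm (CFC.sqrt (s.smoothed T) * CFC.sqrt ρ) ^ 2 :=
      pow_le_pow_left₀ h0 h1 2
    nlinarith

/-- For every state near `ρ`, the root fidelity with `ρ` survives masking up to the square root of
the discarded mass. -/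
theorem le_traceNorm_of_mem_epsBall (T : Set (ℝ × ℝ)) {ε : ℝ} {τ : Matrix (A × B) (A × B) ℂ}
    (hε : 0 ≤ ε) (hτ : τ ∈ epsBall ε ρ) : √(1 - ε ^ 2) - √(s.mass Tᶜ)
      ≤ traceNorm (CFC.sqrt τ * (CFC.sqrt ρ * s.maskedOne T)ᴴ) := by
  obtain ⟨⟨hτ1, hτ2⟩, hτ3⟩ := hτ
  rw [purifiedDistance, Real.sqrt_le_left hε, s.genFidelity_eq] at hτ3
  have h1 : √(1 - ε ^ 2) ≤ traceNorm (CFC.sqrt τ * CFC.sqrt ρ) :=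
    Real.sqrt_le_iff.2 ⟨traceNorm_nonneg _, by linarith⟩
  have h2 := traceNorm_mul_le_of_approx (CFC.sqrt τ) (CFC.sqrt ρ)
    (CFC.sqrt ρ * s.maskedOne T)ᴴ
  have h3 : CFC.sqrt ρ - (CFC.sqrt ρ * s.maskedOne T)ᴴ = (CFC.sqrt ρ * s.maskedOne Tᶜ)ᴴ := by
    rw [← s.one_sub_maskedOne, Matrix.mul_sub, Matrix.conjTranspose_sub, Matrix.mul_one,
      conjTranspose_sqrt]
  rw [h3, hsNormSq_conjTranspose, s.hsNormSq_sqrt_mul_maskedOne,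
    hsNormSq_sqrt_of_posSemidef hτ1] at h2
  have h4 : √τ.trace.re ≤ 1 := by rw [Real.sqrt_le_one]; exact hτ2
  have h5 : √τ.trace.re * √(s.mass Tᶜ) ≤ √(s.mass Tᶜ) :=
    mul_le_of_le_one_left (Real.sqrt_nonneg _) h4
  linarith

variable {b ε l : ℝ}

/-- The smoothed state is dominated by `v l` times `1 ⊗ ρ_B`. -/
theorem le_smoothMinEntropy (hb : 1 < b) (hε : 0 ≤ ε) (hl : 0 < l)
    (h : 2 * s.mass (leSet l)ᶜ ≤ ε ^ 2) :
    ((-Real.logb b (s.numEigenvalues * l) : ℝ) : EReal) ≤ smoothMinEntropy b ε ρ := by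
  have hv : (0 : ℝ) < s.numEigenvalues * l :=
    mul_pos (Nat.cast_pos.2 s.numEigenvalues_pos) hl
  refine le_trans ?_ (le_iSup₂ (f := fun τ (_ : τ ∈ epsBall ε ρ) => minEntropy b τ)
    (s.smoothed (leSet l)) (s.smoothed_mem_epsBall hε h))
  refine le_trans ?_ (le_iSup₂ (partialTraceLeft ρ) s.isSubnormalized_marginal)
  refine le_iSup₂ (f := fun (t : ℝ) _ => (t : EReal)) (-Real.logb b (s.numEigenvalues * l)) ?_
  rw [Set.mem_ofPred_eq, neg_neg, Real.rpow_logb (by linarith) hb.ne' hv]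
  obtain ⟨Y, hY, hXY⟩ := s.exists_bounded_factor hl.le
  set K := (1 : Matrix A A ℂ) ⊗ₖ partialTraceLeft ρ with hK
  have hKp : 0 ≤ K := Matrix.nonneg_iff_posSemidef.2
    (Matrix.PosSemidef.one.kronecker s.isSubnormalized_marginal.1)
  have hKs : (CFC.sqrt K)ᴴ = CFC.sqrt K := conjTranspose_sqrt K
  have e : s.smoothed (leSet l) = (CFC.sqrt K)ᴴ * (Yᴴ * Y) * CFC.sqrt K := by
    rw [smoothed, hXY, Matrix.conjTranspose_mul]
    simp only [Matrix.mul_assoc]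
  have h1 := hY.conjTranspose_mul_mul_same (CFC.sqrt K)
  rw [e, Matrix.le_iff]
  convert h1 using 1
  rw [Matrix.mul_sub, Matrix.sub_mul, Matrix.mul_smul, Matrix.smul_mul, Matrix.mul_one, hKs,
    CFC.sqrt_mul_sqrt_self _ hKp]

/-- By Hölder's inequality the smoothed state has fidelity at most `v l` with every `1 ⊗ σ`. -/
theorem smoothMaxEntropy_le (hb : 1 < b) (hε : 0 ≤ ε) (hl : 0 < l)
    (h : 2 * s.mass (geSet l)ᶜ ≤ ε ^ 2) :
    smoothMaxEntropy b ε ρ ≤ ((Real.logb b (s.numEigenvalues * l) : ℝ) : EReal) := by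
  have hv : (0 : ℝ) < s.numEigenvalues * l :=
    mul_pos (Nat.cast_pos.2 s.numEigenvalues_pos) hl
  refine (iInf₂_le (s.smoothed (geSet l)) (s.smoothed_mem_epsBall hε h)).trans ?_
  refine iSup₂_le fun σ hσ => ?_
  set K := (1 : Matrix A A ℂ) ⊗ₖ σ with hK
  have hKp : 0 ≤ K := Matrix.nonneg_iff_posSemidef.2 (Matrix.PosSemidef.one.kronecker hσ.1)
  have hKs : (CFC.sqrt K)ᴴ = CFC.sqrt K := conjTranspose_sqrt K
  have h1 := traceNorm_sqrt_mul_le (CFC.sqrt ρ) (s.maskedOne (geSet l)) (CFC.sqrt K)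
  rw [s.hsNormSq_sqrt, Real.sqrt_one, one_mul, conjTranspose_sqrt] at h1
  have h2 := s.hsNormSq_maskedOne_mul_le hl.le hσ (C := CFC.sqrt K)
    (by rw [hKs, CFC.sqrt_mul_sqrt_self _ hKp])
  have h3 : fidelity (s.smoothed (geSet l)) K ≤ s.numEigenvalues * l := by
    rw [fidelity, smoothed]
    calc _ ≤ √(hsNormSq (s.maskedOne (geSet l) * CFC.sqrt K)) ^ 2 :=
          pow_le_pow_left₀ (traceNorm_nonneg _) h1 2
      _ ≤ _ := by rwa [Real.sq_sqrt (hsNormSq_nonneg _)]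
  refine (elogb_mono hb (sq_nonneg _) h3).trans ?_
  rw [elogb, if_neg hv.ne']

/-- Every state `τ` in the ball has `tr Z†Z τ ≥ c²`, whereas `tr Z†Z (1 ⊗ σ) ≤ v l` for every `σ`. -/
theorem smoothMinEntropy_le {c : ℝ} (hb : 1 < b) (hε : 0 ≤ ε) (hl : 0 < l) (hc : 0 < c)
    (h : c ≤ √(1 - ε ^ 2) - √(s.mass (geSet l)ᶜ)) :
    smoothMinEntropy b ε ρ ≤ ((Real.logb b (s.numEigenvalues * l / c ^ 2) : ℝ) : EReal) := by
  have hv : (0 : ℝ) < s.numEigenvalues * l :=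
    mul_pos (Nat.cast_pos.2 s.numEigenvalues_pos) hl
  refine iSup₂_le fun τ hτ => iSup₂_le fun σ hσ => iSup₂_le fun t ht => ?_
  rw [EReal.coe_le_coe_iff, Real.le_logb_iff_rpow_le hb (by positivity)]
  rw [Set.mem_ofPred_eq] at ht
  set K := (1 : Matrix A A ℂ) ⊗ₖ σ with hK
  set Z := s.maskedOne (geSet l)
  have hKp : 0 ≤ K := Matrix.nonneg_iff_posSemidef.2 (Matrix.PosSemidef.one.kronecker hσ.1)
  have hKs : (CFC.sqrt K)ᴴ = CFC.sqrt K := conjTranspose_sqrt K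
  have hτp : 0 ≤ τ := Matrix.nonneg_iff_posSemidef.2 hτ.1.1
  have hτs : (CFC.sqrt τ)ᴴ = CFC.sqrt τ := conjTranspose_sqrt τ
  have conv : ∀ {M : Matrix (A × B) (A × B) ℂ}, 0 ≤ M → (CFC.sqrt M)ᴴ = CFC.sqrt M →
      hsNormSq (Z * CFC.sqrt M) = (Z * M * Zᴴ).trace.re := by
    intro M hM hMs
    rw [hsNormSq, Matrix.trace_mul_comm, Matrix.conjTranspose_mul, hMs, Matrix.mul_assoc,
      ← Matrix.mul_assoc (CFC.sqrt M), CFC.sqrt_mul_sqrt_self _ hM, Matrix.mul_assoc]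
  have h1 : c ≤ √(hsNormSq (Z * CFC.sqrt τ)) := by
    have h2 := s.le_traceNorm_of_mem_epsBall (geSet l) hε hτ
    have h3 := traceNorm_conjTranspose_mul_le (Z * CFC.sqrt τ) (CFC.sqrt ρ)
    rw [s.hsNormSq_sqrt, Real.sqrt_one, mul_one, Matrix.conjTranspose_mul, hτs, Matrix.mul_assoc]
      at h3
    rw [Matrix.conjTranspose_mul, conjTranspose_sqrt] at h2
    linarith
  have h2 : c ^ 2 ≤ hsNormSq (Z * CFC.sqrt τ) := by
    rw [← Real.sq_sqrt (hsNormSq_nonneg (Z * CFC.sqrt τ))]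
    exact pow_le_pow_left₀ hc.le h1 2
  have h3 : hsNormSq (Z * CFC.sqrt τ) ≤ b ^ (-t) * hsNormSq (Z * CFC.sqrt K) := by
    have := re_trace_conj_mono ht Zᴴ
    rw [Matrix.conjTranspose_conjTranspose, Matrix.mul_smul, Matrix.smul_mul, Matrix.trace_smul,
      Complex.smul_re, smul_eq_mul] at this
    rwa [conv hτp hτs, conv hKp hKs]
  have h4 := s.hsNormSq_maskedOne_mul_le hl.le hσ (C := CFC.sqrt K)
    (by rw [hKs, CFC.sqrt_mul_sqrt_self _ hKp])
  have hbt : 0 < b ^ t := Real.rpow_pos_of_pos (by linarith) t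
  rw [Real.rpow_neg (by linarith)] at h3
  rw [le_div_iff₀ (by positivity)]
  have h5 : c ^ 2 ≤ (b ^ t)⁻¹ * (s.numEigenvalues * l) :=
    h2.trans (h3.trans (mul_le_mul_of_nonneg_left h4 (inv_nonneg.2 hbt.le)))
  rwa [le_inv_mul_iff₀ hbt] at h5

/-- Every state in the ball has fidelity at least `c² / (v l)` with `1 ⊗ ρ_B`. -/
theorem le_smoothMaxEntropy {c : ℝ} (hb : 1 < b) (hε : 0 ≤ ε) (hl : 0 < l) (hc : 0 < c)
    (h : c ≤ √(1 - ε ^ 2) - √(s.mass (leSet l)ᶜ)) :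
    ((-Real.logb b (s.numEigenvalues * l / c ^ 2) : ℝ) : EReal) ≤ smoothMaxEntropy b ε ρ := by
  have hv : (0 : ℝ) < s.numEigenvalues * l :=
    mul_pos (Nat.cast_pos.2 s.numEigenvalues_pos) hl
  refine le_iInf₂ fun τ hτ => ?_
  refine le_trans ?_ (le_iSup₂ (partialTraceLeft ρ) s.isSubnormalized_marginal)
  set K := (1 : Matrix A A ℂ) ⊗ₖ partialTraceLeft ρ with hK
  obtain ⟨Y, hY, hXY⟩ := s.exists_bounded_factor hl.le
  have hKs : (CFC.sqrt K)ᴴ = CFC.sqrt K := conjTranspose_sqrt K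
  have h1 : c ≤ √(s.numEigenvalues * l) * traceNorm (CFC.sqrt τ * CFC.sqrt K) := by
    have h2 := s.le_traceNorm_of_mem_epsBall (leSet l) hε hτ
    have h3 := traceNorm_mul_conjTranspose_le hv.le hY (CFC.sqrt τ * CFC.sqrt K)
    rw [hXY, Matrix.conjTranspose_mul, hKs, ← Matrix.mul_assoc] at h2
    linarith
  have h2 : c ^ 2 / (s.numEigenvalues * l) ≤ fidelity τ K := by
    rw [div_le_iff₀' hv, fidelity]
    calc c ^ 2 ≤ (√(s.numEigenvalues * l) * traceNorm (CFC.sqrt τ * CFC.sqrt K)) ^ 2 :=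
          pow_le_pow_left₀ hc.le h1 2
      _ = _ := by rw [mul_pow, Real.sq_sqrt hv.le]
  refine le_trans ?_ (elogb_mono hb (by positivity) h2)
  rw [elogb, if_neg (by positivity), ← Real.logb_inv, inv_div]

end SpectralData

end OneShotEntropy

/-! ### Tensor powers and the Chernoff bound -/

section Power

/-- The `n`-fold tensor power of a matrix over a single index type. -/
def matrixPower {S : Type*} (n : ℕ) (X : Matrix S S ℂ) : Matrix (Fin n → S) (Fin n → S) ℂ :=
  Matrix.of fun x y => ∏ i, X (x i) (y i)

theorem matrixPower_mul {S : Type*} [Fintype S] (n : ℕ) (X Y : Matrix S S ℂ) :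
    matrixPower n (X * Y) = matrixPower n X * matrixPower n Y := by
  ext x y
  simp only [matrixPower, Matrix.of_apply, Matrix.mul_apply, Fintype.prod_sum,
    Finset.prod_mul_distrib]

theorem matrixPower_diagonal {S : Type*} [DecidableEq S] (n : ℕ) (d : S → ℝ) :
    matrixPower n (Matrix.diagonal fun i => (d i : ℂ))
      = Matrix.diagonal fun x => ((∏ i, d (x i) : ℝ) : ℂ) := by
  ext x y
  simp only [matrixPower, Matrix.of_apply, Matrix.diagonal_apply]
  split_ifs with h
  · subst h
    simp
  · obtain ⟨i, hi⟩ := Function.ne_iff.1 h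
    exact Finset.prod_eq_zero (Finset.mem_univ i) (if_neg hi)

theorem matrixPower_one {S : Type*} [DecidableEq S] (n : ℕ) :
    matrixPower n (1 : Matrix S S ℂ) = 1 := by
  simpa using matrixPower_diagonal n (fun _ : S => (1 : ℝ))

theorem matrixPower_conjTranspose {S : Type*} (n : ℕ) (X : Matrix S S ℂ) :
    matrixPower n Xᴴ = (matrixPower n X)ᴴ := by
  ext x y
  simp [matrixPower]

variable {A B : Type*}

theorem tensorPower_eq_submatrix (n : ℕ) (X : Matrix (A × B) (A × B) ℂ) :
    tensorPower n X = (matrixPower n X).submatrix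
      (Equiv.arrowProdEquivProdArrow (Fin n) (fun _ => A) fun _ => B).symm
      (Equiv.arrowProdEquivProdArrow (Fin n) (fun _ => A) fun _ => B).symm := rfl

theorem tensorPower_mul [Fintype A] [Fintype B] (n : ℕ) (X Y : Matrix (A × B) (A × B) ℂ) :
    tensorPower n (X * Y) = tensorPower n X * tensorPower n Y := by
  simp only [tensorPower_eq_submatrix, matrixPower_mul, Matrix.submatrix_mul_equiv]

theorem tensorPower_conjTranspose (n : ℕ) (X : Matrix (A × B) (A × B) ℂ) :
    tensorPower n Xᴴ = (tensorPower n X)ᴴ := by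
  simp only [tensorPower_eq_submatrix, matrixPower_conjTranspose, Matrix.conjTranspose_submatrix]

theorem tensorPower_diagonal [DecidableEq A] [DecidableEq B] (n : ℕ) (d : A × B → ℝ) :
    tensorPower n (Matrix.diagonal fun i => (d i : ℂ))
      = Matrix.diagonal fun x => ((∏ i, d (x.1 i, x.2 i) : ℝ) : ℂ) := by
  rw [tensorPower_eq_submatrix, matrixPower_diagonal, Matrix.submatrix_diagonal_equiv]
  rfl

theorem tensorPower_one [DecidableEq A] [DecidableEq B] (n : ℕ) :
    tensorPower n (1 : Matrix (A × B) (A × B) ℂ) = 1 := by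
  simpa using tensorPower_diagonal n (fun _ : A × B => (1 : ℝ))

theorem tensorPower_one_kronecker [DecidableEq A] (n : ℕ) (X : Matrix B B ℂ) :
    tensorPower n ((1 : Matrix A A ℂ) ⊗ₖ X) = (1 : Matrix (Fin n → A) _ ℂ) ⊗ₖ matrixPower n X := by
  rw [← matrixPower_one]
  ext x y
  simp [tensorPower, matrixPower, Finset.prod_mul_distrib]

theorem partialTraceLeft_tensorPower [Fintype A] (n : ℕ) (X : Matrix (A × B) (A × B) ℂ) :
    partialTraceLeft (tensorPower n X) = matrixPower n (partialTraceLeft X) := by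
  ext x y
  simp only [partialTraceLeft, tensorPower, matrixPower, Matrix.of_apply, Fintype.prod_sum]

theorem sum_prod_pair [Fintype A] [Fintype B] (n : ℕ) (f : A × B → ℝ) :
    ∑ x : (Fin n → A) × (Fin n → B), ∏ i, f (x.1 i, x.2 i) = (∑ z, f z) ^ n := by
  classical
  rw [← Equiv.sum_comp (Equiv.arrowProdEquivProdArrow (Fin n) (fun _ => A) fun _ => B)]
  calc _ = ∑ z : Fin n → A × B, ∏ i, f (z i) := rfl
    _ = _ := by rw [← Fintype.prod_sum]; simp

variable [Fintype A] [DecidableEq A] [Fintype B] [DecidableEq B]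

namespace SpectralData

variable {ρ : Matrix (A × B) (A × B) ℂ} (s : SpectralData ρ)

/-- Spectral decompositions of `ρ_AB^{⊗n}` and its marginal. -/
noncomputable def power (n : ℕ) : SpectralData (tensorPower n ρ) where
  U := tensorPower n s.U
  V := matrixPower n s.V
  p x := ∏ i, s.p (x.1 i, x.2 i)
  q y := ∏ i, s.q (y i)
  U_left := by rw [← tensorPower_conjTranspose, ← tensorPower_mul, s.U_left, tensorPower_one]
  U_right := by rw [← tensorPower_conjTranspose, ← tensorPower_mul, s.U_right, tensorPower_one]
  V_left := by rw [← matrixPower_conjTranspose, ← matrixPower_mul, s.V_left, matrixPower_one]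
  V_right := by rw [← matrixPower_conjTranspose, ← matrixPower_mul, s.V_right, matrixPower_one]
  p_nonneg x := Finset.prod_nonneg fun i _ => s.p_nonneg _
  q_nonneg y := Finset.prod_nonneg fun i _ => s.q_nonneg _
  sum_p := by rw [sum_prod_pair, s.sum_p, one_pow]
  eq_joint := by
    rw [← tensorPower_conjTranspose, ← tensorPower_diagonal, ← tensorPower_mul, ← tensorPower_mul,
      ← s.eq_joint]
  eq_marginal := by
    rw [partialTraceLeft_tensorPower, ← matrixPower_conjTranspose, ← matrixPower_diagonal,
      ← matrixPower_mul, ← matrixPower_mul, ← s.eq_marginal]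

theorem power_weight (n : ℕ) (x y : (Fin n → A) × (Fin n → B)) :
    (s.power n).weight x y = ∏ i, s.weight (x.1 i, x.2 i) (y.1 i, y.2 i) := by
  have : (s.power n).W = tensorPower n s.W := by
    simp only [W, E, power]
    rw [tensorPower_mul, tensorPower_conjTranspose, tensorPower_one_kronecker]
  simp only [weight, Finset.prod_mul_distrib, this]
  simp [tensorPower, power, Finset.prod_pow]

/-- The eigenvalues of `ρ_B^{⊗n}` are determined by types, of which there are polynomially
many. -/
theorem power_numEigenvalues_le (n : ℕ) :
    (s.power n).numEigenvalues ≤ (n + 1) ^ Fintype.card B := by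
  classical
  have hsub : (Finset.univ.image fun j : (Fin n → A) × (Fin n → B) => (s.power n).q j.2)
      ⊆ Finset.univ.image fun m : B → Fin (n + 1) => ∏ z, s.q z ^ (m z : ℕ) := by
    intro k hk
    obtain ⟨j, -, rfl⟩ := Finset.mem_image.1 hk
    refine Finset.mem_image.2
      ⟨fun z => ⟨(Finset.univ.filter fun i => j.2 i = z).card, ?_⟩, Finset.mem_univ _, ?_⟩
    · exact Nat.lt_succ_of_le ((Finset.card_le_univ _).trans (by simp))
    · change _ = ∏ i, s.q (j.2 i)
      rw [← Finset.prod_fiberwise' Finset.univ j.2 s.q]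
      simp
  refine (Finset.card_le_card hsub).trans (Finset.card_image_le.trans ?_)
  simp

/-- The mass of a set of eigenvalue pairs of `ρ_AB^{⊗n}` on which a sum of independent terms is
nonnegative is bounded by the `n`-th power of the exponential moment of one term. -/
theorem power_mass_le (n : ℕ) (T : Set (ℝ × ℝ)) (f : A × B → A × B → ℝ)
    (h : ∀ x y : (Fin n → A) × (Fin n → B),
      (∀ i, s.weight (x.1 i, x.2 i) (y.1 i, y.2 i) ≠ 0) →
      ((s.power n).p x, (s.power n).q y.2) ∈ T → 0 ≤ ∑ i, f (x.1 i, x.2 i) (y.1 i, y.2 i))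
    {r : ℝ} (hr : 0 ≤ r) :
    (s.power n).mass T ≤ (∑ i, ∑ j, s.weight i j * Real.exp (r * f i j)) ^ n := by
  have e : (∑ i, ∑ j, s.weight i j * Real.exp (r * f i j)) ^ n
      = ∑ x : (Fin n → A) × (Fin n → B), ∑ y : (Fin n → A) × (Fin n → B),
        ∏ i, (s.weight (x.1 i, x.2 i) (y.1 i, y.2 i) *
          Real.exp (r * f (x.1 i, x.2 i) (y.1 i, y.2 i))) := by
    rw [← sum_prod_pair]
    simp only [Fintype.prod_sum]
    refine Finset.sum_congr rfl fun x _ => ?_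
    rw [← Equiv.sum_comp (Equiv.arrowProdEquivProdArrow (Fin n) (fun _ => A) fun _ => B)]
    rfl
  rw [e, mass]
  refine Finset.sum_le_sum fun x _ => Finset.sum_le_sum fun y _ => ?_
  have h0 : 0 ≤ ∏ i, (s.weight (x.1 i, x.2 i) (y.1 i, y.2 i) *
      Real.exp (r * f (x.1 i, x.2 i) (y.1 i, y.2 i))) :=
    Finset.prod_nonneg fun i _ => mul_nonneg (s.weight_nonneg _ _) (Real.exp_pos _).le
  split_ifs with hT
  · rw [Finset.prod_mul_distrib, ← s.power_weight, ← Real.exp_sum, ← Finset.mul_sum]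
    by_cases hw : ∀ i, s.weight (x.1 i, x.2 i) (y.1 i, y.2 i) ≠ 0
    · exact le_mul_of_one_le_right ((s.power n).weight_nonneg _ _)
        (Real.one_le_exp (mul_nonneg hr (h x y hw hT)))
    · push Not at hw
      obtain ⟨i, hi⟩ := hw
      rw [s.power_weight, Finset.prod_eq_zero (Finset.mem_univ i) hi, zero_mul]
  · exact h0

theorem sum_weight : ∑ i, ∑ j, s.weight i j = 1 := by
  simp only [s.sum_weight_right, s.sum_p]

/-- The exponential moment equals one at zero, where its derivative is the mean. -/
theorem exists_exp_moment_lt_one (f : A × B → A × B → ℝ)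
    (hf : ∑ i, ∑ j, s.weight i j * f i j < 0) :
    ∃ r : ℝ, 0 ≤ r ∧ ∑ i, ∑ j, s.weight i j * Real.exp (r * f i j) < 1 := by
  have hd : HasDerivAt (fun r : ℝ => ∑ i, ∑ j, s.weight i j * Real.exp (r * f i j))
      (∑ i, ∑ j, s.weight i j * f i j) 0 := by
    refine HasDerivAt.fun_sum fun i _ => HasDerivAt.fun_sum fun j _ => ?_
    have := (((hasDerivAt_id (0 : ℝ)).mul_const (f i j)).exp).const_mul (s.weight i j)
    simpa using this
  have h1 := (hasDerivWithinAt_iff_tendsto_slope.1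
    (hd.hasDerivWithinAt (s := Set.Ioi 0))).eventually_lt_const hf
  rw [Set.sdiff_singleton_eq_self (by simp)] at h1
  obtain ⟨r, hr, hr0⟩ := (h1.and self_mem_nhdsWithin).exists
  refine ⟨r, le_of_lt hr0, ?_⟩
  have hr0' : (0 : ℝ) < r := hr0
  rw [slope_def_field, sub_zero, div_lt_iff₀ hr0', zero_mul] at hr
  simp only [zero_mul, Real.exp_zero, mul_one, s.sum_weight] at hr
  linarith

/-- Chernoff bound: a set of eigenvalue pairs on which a sum of independent terms of negative mean
is nonnegative has vanishing mass. -/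
theorem tendsto_power_mass (T : ℕ → Set (ℝ × ℝ)) (f : A × B → A × B → ℝ)
    (hf : ∑ i, ∑ j, s.weight i j * f i j < 0)
    (h : ∀ n, ∀ x y : (Fin n → A) × (Fin n → B),
      (∀ i, s.weight (x.1 i, x.2 i) (y.1 i, y.2 i) ≠ 0) →
      ((s.power n).p x, (s.power n).q y.2) ∈ T n →
        0 ≤ ∑ i, f (x.1 i, x.2 i) (y.1 i, y.2 i)) :
    Filter.Tendsto (fun n => (s.power n).mass (T n)) Filter.atTop (𝓝 0) := by
  obtain ⟨r, hr0, hr1⟩ := s.exists_exp_moment_lt_one f hf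
  refine squeeze_zero (fun n => (s.power n).mass_nonneg _)
    (fun n => s.power_mass_le n (T n) f (h n) hr0)
    (tendsto_pow_atTop_nhds_zero_of_lt_one ?_ hr1)
  exact Finset.sum_nonneg fun i _ => Finset.sum_nonneg fun j _ =>
    mul_nonneg (s.weight_nonneg i j) (Real.exp_pos _).le

theorem sum_weight_left (j : B) : ∑ i, ∑ a, s.weight i (a, j) = s.q j := by
  have h := s.sum_overlap j j
  rw [if_pos rfl, Finset.sum_comm] at h
  have h2 : ∀ i a, star (s.W i (a, j)) * (s.p i : ℂ) * s.W i (a, j)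
      = ((s.weight i (a, j) : ℝ) : ℂ) := by
    intro i a
    rw [weight, mul_right_comm, RCLike.star_def, Complex.conj_mul', mul_comm]
    push_cast
    rfl
  simp only [h2] at h
  exact_mod_cast h

theorem p_pos_of_weight_ne_zero {i j : A × B} (h : s.weight i j ≠ 0) : 0 < s.p i :=
  (s.p_nonneg i).lt_of_ne fun h0 => h (by rw [weight, ← h0, zero_mul])

/-- The support of `ρ_AB` lies in that of `1 ⊗ ρ_B`. -/
theorem q_pos_of_weight_ne_zero {i j : A × B} (h : s.weight i j ≠ 0) : 0 < s.q j.2 := by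
  refine (s.q_nonneg j.2).lt_of_ne fun h0 => h ?_
  have h1 := s.sum_weight_left j.2
  rw [← h0, Finset.sum_eq_zero_iff_of_nonneg
    (fun i _ => Finset.sum_nonneg fun a _ => s.weight_nonneg _ _)] at h1
  have h2 := h1 i (Finset.mem_univ i)
  rw [Finset.sum_eq_zero_iff_of_nonneg (fun a _ => s.weight_nonneg _ _)] at h2
  exact h2 j.1 (Finset.mem_univ _)

/-- The logarithmic ratio of the eigenvalues of `ρ_AB` and `1 ⊗ ρ_B`. -/
noncomputable def logRatio (b : ℝ) (i j : A × B) : ℝ := Real.logb b (s.p i) - Real.logb b (s.q j.2)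

/-- The mean of the logarithmic ratio is the negative conditional entropy. -/
theorem sum_weight_mul_logRatio (b : ℝ) : ∑ i, ∑ j, s.weight i j * s.logRatio b i j
    = ∑ i, s.p i * Real.logb b (s.p i) - ∑ j, s.q j * Real.logb b (s.q j) := by
  simp only [logRatio, mul_sub, Finset.sum_sub_distrib, ← Finset.sum_mul, s.sum_weight_right]
  congr 1
  simp only [Fintype.sum_prod_type_right (f := fun j : A × B => s.weight _ j * _), ← Finset.sum_mul]
  rw [Finset.sum_comm]
  simp only [← Finset.sum_mul, s.sum_weight_left]

theorem power_p_pos {n : ℕ} {x y : (Fin n → A) × (Fin n → B)}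
    (h : ∀ i, s.weight (x.1 i, x.2 i) (y.1 i, y.2 i) ≠ 0) : 0 < (s.power n).p x := by
  change 0 < ∏ i, s.p (x.1 i, x.2 i)
  exact Finset.prod_pos fun i _ => s.p_pos_of_weight_ne_zero (h i)

theorem power_q_pos {n : ℕ} {x y : (Fin n → A) × (Fin n → B)}
    (h : ∀ i, s.weight (x.1 i, x.2 i) (y.1 i, y.2 i) ≠ 0) : 0 < (s.power n).q y.2 := by
  change 0 < ∏ i, s.q (y.2 i)
  exact Finset.prod_pos fun i _ => s.q_pos_of_weight_ne_zero (h i)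

theorem logb_power_sub (b : ℝ) {n : ℕ} {x y : (Fin n → A) × (Fin n → B)}
    (h : ∀ i, s.weight (x.1 i, x.2 i) (y.1 i, y.2 i) ≠ 0) :
    Real.logb b ((s.power n).p x) - Real.logb b ((s.power n).q y.2)
      = ∑ i, s.logRatio b (x.1 i, x.2 i) (y.1 i, y.2 i) := by
  simp only [power, logRatio, Finset.sum_sub_distrib]
  rw [Real.logb_prod _ _ fun i _ => (s.p_pos_of_weight_ne_zero (h i)).ne',
    Real.logb_prod _ _ fun i _ => (s.q_pos_of_weight_ne_zero (h i)).ne']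

theorem tendsto_mass_leSet_compl {b x : ℝ} (hb : 1 < b)
    (hx : ∑ i, ∑ j, s.weight i j * s.logRatio b i j < x) :
    Filter.Tendsto (fun n : ℕ => (s.power n).mass (leSet (b ^ (n * x)))ᶜ) Filter.atTop (𝓝 0) := by
  refine s.tendsto_power_mass _ (fun i j => s.logRatio b i j - x) ?_ ?_
  · simp only [mul_sub, Finset.sum_sub_distrib, ← Finset.sum_mul, s.sum_weight]
    linarith
  · intro n y z hw hT
    have hb0 : 0 < b := by linarith
    have hp := s.power_p_pos hw
    have hq := s.power_q_pos hw
    have hlt : b ^ (n * x) * (s.power n).q z.2 < (s.power n).p y := not_le.1 hT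
    have := Real.logb_lt_logb hb (by positivity) hlt
    rw [Real.logb_mul (by positivity) hq.ne', Real.logb_rpow hb0 hb.ne'] at this
    have h2 := s.logb_power_sub b hw
    simp only [Finset.sum_sub_distrib, Finset.sum_const, Finset.card_univ, Fintype.card_fin,
      nsmul_eq_mul]
    linarith

theorem tendsto_mass_geSet_compl {b x : ℝ} (hb : 1 < b)
    (hx : -x < ∑ i, ∑ j, s.weight i j * s.logRatio b i j) :
    Filter.Tendsto (fun n : ℕ => (s.power n).mass (geSet (b ^ (n * x)))ᶜ) Filter.atTop (𝓝 0) := by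
  refine s.tendsto_power_mass _ (fun i j => -s.logRatio b i j - x) ?_ ?_
  · simp only [mul_sub, mul_neg, Finset.sum_sub_distrib, Finset.sum_neg_distrib, ← Finset.sum_mul,
      s.sum_weight]
    linarith
  · intro n y z hw hT
    have hb0 : 0 < b := by linarith
    have hp := s.power_p_pos hw
    have hq := s.power_q_pos hw
    have hlt : b ^ (n * x) * (s.power n).p y < (s.power n).q z.2 :=
      not_le.1 fun h => hT ⟨hq, h⟩
    have := Real.logb_lt_logb hb (by positivity) hlt
    rw [Real.logb_mul (by positivity) hp.ne', Real.logb_rpow hb0 hb.ne'] at this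
    have h2 := s.logb_power_sub b hw
    simp only [Finset.sum_sub_distrib, Finset.sum_neg_distrib, Finset.sum_const, Finset.card_univ,
      Fintype.card_fin, nsmul_eq_mul]
    linarith

end SpectralData

end Power

section State

theorem conj_diagonal_eigenvalues {S : Type*} [Fintype S] [DecidableEq S] {ρ : Matrix S S ℂ}
    (h : ρ.IsHermitian) :
    ρ = h.eigenvectorUnitary * Matrix.diagonal (fun i => (h.eigenvalues i : ℂ)) *
      (h.eigenvectorUnitary : Matrix S S ℂ)ᴴ := by
  conv_lhs => rw [h.spectral_theorem, Unitary.conjStarAlgAut_apply]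
  rfl

theorem vonNeumannEntropy_eq {S : Type*} [Fintype S] [DecidableEq S] {ρ : Matrix S S ℂ}
    (h : ρ.IsHermitian) (b : ℝ) :
    vonNeumannEntropy b ρ = -∑ i, h.eigenvalues i * Real.logb b (h.eigenvalues i) := by
  rw [vonNeumannEntropy, h.cfc_eq, Matrix.IsHermitian.cfc, Unitary.conjStarAlgAut_apply,
    Matrix.trace_mul_comm, ← Matrix.mul_assoc, Unitary.coe_star_mul_self, Matrix.one_mul,
    Matrix.trace_diagonal]
  simp

variable {A B : Type*} [Fintype A]

theorem posSemidef_partialTraceLeft {ρ : Matrix (A × B) (A × B) ℂ} (h : ρ.PosSemidef) :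
    (partialTraceLeft ρ).PosSemidef := by
  have : partialTraceLeft ρ = ∑ a, ρ.submatrix (fun b => (a, b)) fun b => (a, b) := by
    ext b b'
    simp [partialTraceLeft, Matrix.sum_apply]
  rw [this]
  exact Matrix.posSemidef_sum _ fun a _ => h.submatrix _

variable [DecidableEq A] [Fintype B] [DecidableEq B]

/-- Every state has spectral data whose mean logarithmic ratio is the negative conditional
entropy. -/
theorem exists_spectralData {ρ : Matrix (A × B) (A × B) ℂ} (hρ : IsState ρ) (b : ℝ) :
    ∃ s : SpectralData ρ,
      ∑ i, ∑ j, s.weight i j * s.logRatio b i j = -condEntropy b ρ := by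
  have h := hρ.1.isHermitian
  have hB := posSemidef_partialTraceLeft hρ.1
  refine ⟨{
    U := h.eigenvectorUnitary
    V := hB.isHermitian.eigenvectorUnitary
    p := h.eigenvalues
    q := hB.isHermitian.eigenvalues
    U_left := Unitary.coe_star_mul_self _
    U_right := Unitary.coe_mul_star_self _
    V_left := Unitary.coe_star_mul_self _
    V_right := Unitary.coe_mul_star_self _
    p_nonneg := hρ.1.eigenvalues_nonneg
    q_nonneg := hB.eigenvalues_nonneg
    sum_p := ?_
    eq_joint := conj_diagonal_eigenvalues h
    eq_marginal := conj_diagonal_eigenvalues hB.isHermitian }, ?_⟩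
  · have := h.trace_eq_sum_eigenvalues
    rw [hρ.2] at this
    have h1 : ((∑ i, h.eigenvalues i : ℝ) : ℂ) = 1 := by
      rw [Complex.ofReal_sum]
      exact this.symm
    exact_mod_cast h1
  · rw [SpectralData.sum_weight_mul_logRatio, condEntropy, vonNeumannEntropy_eq h,
      vonNeumannEntropy_eq hB.isHermitian]
    ring

end State

/-! ### The asymptotic limit -/

section Limit

open Filter

theorem tendsto_ereal_div_of_bounds {u : ℕ → EReal} {H : ℝ}
    (h : ∀ δ > 0, ∀ᶠ n : ℕ in atTop,
      ((n * (H - δ) : ℝ) : EReal) ≤ u n ∧ u n ≤ ((n * (H + δ) : ℝ) : EReal)) :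
    Tendsto (fun n : ℕ => u n / (n : EReal)) atTop (𝓝 (H : EReal)) := by
  have key : ∀ δ > 0, ∀ᶠ n : ℕ in atTop,
      ((H - δ : ℝ) : EReal) ≤ u n / (n : EReal) ∧ u n / (n : EReal) ≤ ((H + δ : ℝ) : EReal) := by
    intro δ hδ
    filter_upwards [h δ hδ, eventually_gt_atTop 0] with n hn hn0
    have h0 : (0 : EReal) < (n : EReal) := by exact_mod_cast hn0
    have ht : (n : EReal) ≠ ⊤ := EReal.natCast_ne_top n
    have hcast : ∀ x : ℝ, ((n * x : ℝ) : EReal) = (x : EReal) * (n : EReal) := by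
      intro x
      rw [mul_comm, EReal.coe_mul]
      rfl
    rw [hcast, hcast] at hn
    exact ⟨(EReal.le_div_iff_mul_le h0 ht).2 hn.1, (EReal.div_le_iff_le_mul h0 ht).2
      (by rw [mul_comm]; exact hn.2)⟩
  refine tendsto_order.2 ⟨fun a ha => ?_, fun a ha => ?_⟩
  · obtain ⟨x, hax, hxH⟩ := EReal.lt_iff_exists_real_btwn.1 ha
    have hx : x < H := EReal.coe_lt_coe_iff.1 hxH
    filter_upwards [key (H - x) (sub_pos.2 hx)] with n hn
    rw [sub_sub_cancel] at hn
    exact hax.trans_le hn.1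
  · obtain ⟨x, hxH, hax⟩ := EReal.lt_iff_exists_real_btwn.1 ha
    have hx : H < x := EReal.coe_lt_coe_iff.1 hxH
    filter_upwards [key (x - H) (sub_pos.2 hx)] with n hn
    rw [add_sub_cancel] at hn
    exact hn.2.trans_lt hax

/-- Logarithms of polynomials in `n` are eventually below every positive multiple of `n`. -/
theorem eventually_logb_pow_add_le (b K : ℝ) (d : ℕ) {δ : ℝ} (hδ : 0 < δ) :
    ∀ᶠ n : ℕ in atTop, d * Real.logb b (n + 1) + K ≤ n * δ := by
  have h1 : Tendsto (fun n : ℕ => Real.log ((n : ℝ) + 1) / ((n : ℝ) + 1)) atTop (𝓝 0) :=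
    (Real.isLittleO_log_id_atTop.tendsto_div_nhds_zero).comp
      (tendsto_atTop_add_const_right _ 1 tendsto_natCast_atTop_atTop)
  have h2 : Tendsto (fun n : ℕ => (d / Real.log b) * (Real.log ((n : ℝ) + 1) / ((n : ℝ) + 1))
      + (K + δ) * (1 / ((n : ℝ) + 1))) atTop (𝓝 (d / Real.log b * 0 + (K + δ) * 0)) :=
    (h1.const_mul _).add (tendsto_one_div_add_atTop_nhds_zero_nat.const_mul _)
  rw [mul_zero, mul_zero, add_zero] at h2
  filter_upwards [h2.eventually_lt_const hδ] with n hn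
  have hn0 : (0 : ℝ) < n + 1 := by positivity
  have h3 : (d / Real.log b) * (Real.log ((n : ℝ) + 1) / ((n : ℝ) + 1))
      + (K + δ) * (1 / ((n : ℝ) + 1)) = (d * Real.logb b (n + 1) + (K + δ)) / (n + 1) := by
    rw [Real.logb]
    ring
  rw [h3, div_lt_iff₀ hn0] at hn
  linarith

/-- A vanishing sequence of discarded masses is eventually small enough for both one-shot
conditions. -/
theorem eventually_mass_small {ε : ℝ} {u : ℕ → ℝ} (hu : Tendsto u atTop (𝓝 0)) (hε0 : 0 < ε)
    (hε1 : ε < 1) : ∀ᶠ n in atTop, 2 * u n ≤ ε ^ 2 ∧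
      √(1 - ε ^ 2) / 2 ≤ √(1 - ε ^ 2) - √(u n) := by
  have hc : 0 < √(1 - ε ^ 2) := Real.sqrt_pos.2 (by nlinarith)
  have h1 : Tendsto (fun n => 2 * u n) atTop (𝓝 0) := by simpa using hu.const_mul 2
  have h2 : Tendsto (fun n => √(u n)) atTop (𝓝 0) := by simpa using hu.sqrt
  filter_upwards [h1.eventually_le_const (show 0 < ε ^ 2 by positivity),
    h2.eventually_le_const (half_pos hc)] with n hn1 hn2
  exact ⟨hn1, by linarith⟩

namespace SpectralData

variable {A B : Type*} [Fintype A] [DecidableEq A] [Fintype B] [DecidableEq B]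
  {ρ : Matrix (A × B) (A × B) ℂ} (s : SpectralData ρ)

/-- The number of eigenvalues of `ρ_B^{⊗n}` and constant factors do not affect the rate. -/
theorem eventually_logb_numEigenvalues_mul_le {b c x y : ℝ} (hb : 1 < b) (hc : 0 < c)
    (hxy : x < y) : ∀ᶠ n : ℕ in atTop,
      Real.logb b ((s.power n).numEigenvalues * b ^ (n * x) / c ^ 2) ≤ n * y := by
  have hb0 : 0 < b := by linarith
  filter_upwards [eventually_logb_pow_add_le b (-Real.logb b (c ^ 2)) (Fintype.card B)
    (sub_pos.2 hxy)] with n hn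
  have hv : (0 : ℝ) < (s.power n).numEigenvalues := Nat.cast_pos.2 (s.power n).numEigenvalues_pos
  rw [Real.logb_div (by positivity) (by positivity), Real.logb_mul hv.ne' (by positivity),
    Real.logb_rpow hb0 hb.ne']
  have h1 : Real.logb b (s.power n).numEigenvalues ≤ Fintype.card B * Real.logb b (n + 1) := by
    rw [← Real.logb_pow]
    exact Real.logb_le_logb_of_le hb hv (by exact_mod_cast s.power_numEigenvalues_le n)
  linarith

variable {b ε : ℝ}

/-- Both smooth entropies have rate `H`, the negative mean of the logarithmic ratio. -/
theorem tendsto_smoothEntropies (hb : 1 < b) (hε0 : 0 < ε) (hε1 : ε < 1) {H : ℝ}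
    (hH : ∑ i, ∑ j, s.weight i j * s.logRatio b i j = -H) :
    Tendsto (fun n : ℕ => smoothMinEntropy b ε (tensorPower n ρ) / (n : EReal)) atTop
      (𝓝 (H : EReal)) ∧
    Tendsto (fun n : ℕ => smoothMaxEntropy b ε (tensorPower n ρ) / (n : EReal)) atTop
      (𝓝 (H : EReal)) := by
  have hb0 : 0 < b := by linarith
  have hc : 0 < √(1 - ε ^ 2) / 2 := half_pos (Real.sqrt_pos.2 (by nlinarith))
  have hge : ∀ δ > 0, ∀ᶠ n : ℕ in atTop,
      smoothMaxEntropy b ε (tensorPower n ρ) ≤ ((n * (H + δ) : ℝ) : EReal) ∧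
      smoothMinEntropy b ε (tensorPower n ρ) ≤ ((n * (H + δ) : ℝ) : EReal) := by
    intro δ hδ
    have hx : H + δ / 2 < H + δ := by linarith
    filter_upwards [eventually_mass_small (s.tendsto_mass_geSet_compl (x := H + δ / 2) hb
      (by rw [hH]; linarith)) hε0 hε1,
      s.eventually_logb_numEigenvalues_mul_le hb one_pos hx,
      s.eventually_logb_numEigenvalues_mul_le hb hc hx] with n hn h1 hcn
    rw [one_pow, div_one] at h1
    have hl : 0 < b ^ (n * (H + δ / 2)) := Real.rpow_pos_of_pos hb0 _
    exact ⟨((s.power n).smoothMaxEntropy_le hb hε0.le hl hn.1).trans (EReal.coe_le_coe_iff.2 h1),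
      ((s.power n).smoothMinEntropy_le hb hε0.le hl hc hn.2).trans (EReal.coe_le_coe_iff.2 hcn)⟩
  have hle : ∀ δ > 0, ∀ᶠ n : ℕ in atTop,
      ((n * (H - δ) : ℝ) : EReal) ≤ smoothMinEntropy b ε (tensorPower n ρ) ∧
      ((n * (H - δ) : ℝ) : EReal) ≤ smoothMaxEntropy b ε (tensorPower n ρ) := by
    intro δ hδ
    have hx : -H + δ / 2 < -H + δ := by linarith
    filter_upwards [eventually_mass_small (s.tendsto_mass_leSet_compl (x := -H + δ / 2) hb
      (by rw [hH]; linarith)) hε0 hε1,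
      s.eventually_logb_numEigenvalues_mul_le hb one_pos hx,
      s.eventually_logb_numEigenvalues_mul_le hb hc hx] with n hn h1 hcn
    rw [one_pow, div_one] at h1
    have hl : 0 < b ^ (n * (-H + δ / 2)) := Real.rpow_pos_of_pos hb0 _
    refine ⟨le_trans (EReal.coe_le_coe_iff.2 ?_) ((s.power n).le_smoothMinEntropy hb hε0.le hl hn.1),
      le_trans (EReal.coe_le_coe_iff.2 ?_)
        ((s.power n).le_smoothMaxEntropy hb hε0.le hl hc hn.2)⟩ <;> linarith
  constructor
  · refine tendsto_ereal_div_of_bounds fun δ hδ => ?_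
    filter_upwards [hge δ hδ, hle δ hδ] with n h1 h2
    exact ⟨h2.1, h1.2⟩
  · refine tendsto_ereal_div_of_bounds fun δ hδ => ?_
    filter_upwards [hge δ hδ, hle δ hδ] with n h1 h2
    exact ⟨h2.2, h1.1⟩

end SpectralData

end Limit

end QuantumAEP

theorem mainTheorem5 {A B : Type*} [Fintype A] [DecidableEq A] [Fintype B] [DecidableEq B]
    (b : ℝ) (hb : 1 < b) (ρ : Matrix (A × B) (A × B) ℂ) (hρ : QuantumAEP.IsState ρ)
    (ε : ℝ) (hε0 : 0 < ε) (hε1 : ε < 1) :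
    (∃ L : ℝ,
      Filter.Tendsto
        (fun n : ℕ =>
          QuantumAEP.smoothMinEntropy b ε (QuantumAEP.tensorPower n ρ) / (n : EReal))
        Filter.atTop (𝓝 (L : EReal)) ∧
      QuantumAEP.condEntropy b ρ ≤ L) ∧
    (∃ L : ℝ,
      Filter.Tendsto
        (fun n : ℕ =>
          QuantumAEP.smoothMaxEntropy b ε (QuantumAEP.tensorPower n ρ) / (n : EReal))
        Filter.atTop (𝓝 (L : EReal)) ∧
      L ≤ QuantumAEP.condEntropy b ρ) := by
  obtain ⟨s, hs⟩ := QuantumAEP.exists_spectralData hρ b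
  obtain ⟨hmin, hmax⟩ := s.tendsto_smoothEntropies hb hε0 hε1 hs
  exact ⟨⟨_, hmin, le_rfl⟩, ⟨_, hmax, le_rfl⟩⟩
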